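/- Fix integers $\tilde K,\hat K\ge 1$ and parameters $\alpha,\beta,\gamma\in\{-1,0,1\}$. An instance consists of $n$ elements, two category maps $\tilde o:\{1,\dots,n\}\to\{1,\dots,\tilde K\}$ and $\hat o:\{1,\dots,n\}\to\{1,\dots,\hat K\}$ (smaller category numbers being better), and coefficients $f_1,\dots,f_n\ge 0$. For $x\in\{0,1\}^n$ let $\tilde c(x)\in\mathbb Z^{\tilde K}$ be the incremental counting vector $\tilde c_j(x)=\sum_{i:\,j\le \tilde o(i)}x_i$ (the number of selected elements in category $j$ or worse), let $\hat c(x)\in\mathbb Z^{\hat K}$ be defined in the same way from $\hat o$, let $f(x)=\sum_{i=1}^n f_i x_i$, and let $$z(x)=\bigl(\alpha\,\tilde c(x),\ \beta\,\hat c(x),\ \gamma f(x)\bigr).$$ Problem $\alpha\beta\gamma$-OMUCO is to minimize $z(x)$ subject to $x\in\{0,1\}^n$; problem $\alpha\beta\gamma$-OMCOCC, whose instances contain in addition an integer $w\in\{0,\dots,n\}$, is to minimize $z(x)$ subject to $x\in\{0,1\}^n$ and $\sum_{i=1}^n x_i=w$. A feasible solution $x$ is efficient if there is no feasible $y$ with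 $z(y)\le z(x)$ componentwise and $z(y)\ne z(x)$. The nondominated set $Z_N$ is the set of the outcome vectors $z(x)$ of all efficient $x$, and a minimal complete set $\bar X_E$ is a set of efficient solutions that contains exactly one preimage of each element of $Z_N$. Then, for fixed $\tilde K,\hat K$ (and $\alpha,\beta,\gamma$), the nondominated set $Z_N$ and a minimal complete set $\bar X_E$ of $\alpha\beta\gamma$-OMUCO can be computed in polynomial time, and the same holds for $\alpha\beta\gamma$-OMCOCC. Here polynomial time means that there is one program of a random access machine such that (i) for real coefficients $f_i$, its cost is bounded by a polynomial in $n$, where exact additions, subtractions, multiplications and comparisons of real numbers cost one unit each and integers and addresses are charged by their binary length, and (ii) for rational coefficients $f_i$, its cost, with all numbers charged by their binary length, is bounded by a polynomial in the binary encoding length of the instance. -/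

import Mathlib

namespace OrdMUCO

/-! ### Instances, outcome vectors, efficiency -/

/-- An instance with `n` elements, two ordinal objectives with `Kt` and `Kh` categories
(the category with index `j` is better than the one with index `k` if `j < k`), and one sum
objective with nonnegative coefficients `f` in `F`. -/
structure Inst (F : Type) [Zero F] [LE F] (Kt Kh n : ℕ) where
  catT : Fin n → Fin Kt
  catH : Fin n → Fin Kh
  f : Fin n → F
  f_nonneg : ∀ i, 0 ≤ f i

/-- A solution `x ∈ {0,1}^n`; `true` stands for `1`. -/
abbrev Sol (n : ℕ) : Type := Fin n → Bool

/-- The number `x_i ∈ {0,1}`. -/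
def bit {n : ℕ} (x : Sol n) (i : Fin n) : ℤ := if x i then 1 else 0

/-- The entry `c^i_j` of the binary cost matrix of an ordinal objective with category map `o`. -/
def costEntry {n K : ℕ} (o : Fin n → Fin K) (i : Fin n) (j : Fin K) : ℤ :=
  if j ≤ o i then 1 else 0

/-- The incremental counting vector: component `j` of `c(x) = ∑ i, x_i c^i` is the number of
selected elements that are in category `j` or worse. -/
def countVec {n K : ℕ} (o : Fin n → Fin K) (x : Sol n) (j : Fin K) : ℤ :=
  ∑ i, costEntry o i j * bit x i

/-- The sum objective `f(x) = ∑ i, f_i x_i`. -/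
def sumObj {F : Type} [Ring F] {n : ℕ} (f : Fin n → F) (x : Sol n) : F :=
  ∑ i, f i * (bit x i : F)

/-- Outcome vectors, with the componentwise order. -/
abbrev Outcome (F : Type) (Kt Kh : ℕ) : Type := (Fin Kt → ℤ) × (Fin Kh → ℤ) × F

/-- `z(x) = (α c̃(x), β ĉ(x), γ f(x))`. -/
def outcome {F : Type} [Ring F] [LinearOrder F] {Kt Kh n : ℕ} (α β γ : ℤ)
    (I : Inst F Kt Kh n) (x : Sol n) : Outcome F Kt Kh :=
  (fun j => α * countVec I.catT x j, fun j => β * countVec I.catH x j, (γ : F) * sumObj I.f x)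

/-- `a` dominates `b`. -/
def Dominates {F : Type} [LinearOrder F] {Kt Kh : ℕ} (a b : Outcome F Kt Kh) : Prop :=
  a ≤ b ∧ a ≠ b

/-- The efficient solutions of `min z(x)` subject to `x ∈ X`. -/
def efficientSet {F : Type} [LinearOrder F] {Kt Kh n : ℕ} (X : Set (Sol n))
    (z : Sol n → Outcome F Kt Kh) : Set (Sol n) :=
  {x | x ∈ X ∧ ¬ ∃ y ∈ X, Dominates (z y) (z x)}

/-- The nondominated set of `min z(x)` subject to `x ∈ X`. -/
def nondominatedSet {F : Type} [LinearOrder F] {Kt Kh n : ℕ} (X : Set (Sol n))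
    (z : Sol n → Outcome F Kt Kh) : Set (Outcome F Kt Kh) :=
  z '' efficientSet X z

/-- `S` consists of exactly one efficient solution for each nondominated outcome vector. -/
def IsMinimalComplete {F : Type} [LinearOrder F] {Kt Kh n : ℕ} (X : Set (Sol n))
    (z : Sol n → Outcome F Kt Kh) (S : Set (Sol n)) : Prop :=
  S ⊆ efficientSet X z ∧ ∀ v ∈ nondominatedSet X z, ∃! x, x ∈ S ∧ z x = v

/-- The solutions with exactly `w` selected elements. -/
def cardFeasible (n w : ℕ) : Set (Sol n) := {x | ∑ i, bit x i = (w : ℤ)}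

/-! ### The machine model

A random access machine, programmed by structured programs, whose memory consists of integer and
`F`-valued registers and arrays (array cells are addressed by integers). Programs contain no
constants from `F`, so the same program runs over every ordered ring `F`.

Every operation is charged one unit plus the size of its result (operands and addresses are
results of operations themselves, so they are charged as well). Integers, including addresses,
have their binary length as size. The size of elements of `F` is a parameter `rs` of the cost
measure: constantly one for exact real arithmetic, binary length for rational numbers. -/

/-- Integer expressions. -/
inductive IExp : Type
  | const (c : ℤ)
  | var (r : ℕ)
  | arr (a : ℕ) (idx : IExp)
  | add (e₁ e₂ : IExp)
  | sub (e₁ e₂ : IExp)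
  | mul (e₁ e₂ : IExp)

/-- Expressions with values in `F`. -/
inductive RExp : Type
  | ofInt (e : IExp)
  | var (r : ℕ)
  | arr (a : ℕ) (idx : IExp)
  | add (e₁ e₂ : RExp)
  | sub (e₁ e₂ : RExp)
  | mul (e₁ e₂ : RExp)

/-- Tests. -/
inductive BExp : Type
  | leI (e₁ e₂ : IExp)
  | leR (e₁ e₂ : RExp)
  | not (b : BExp)
  | and (b₁ b₂ : BExp)

/-- Programs. -/
inductive Prog : Type
  | skip
  | setIVar (r : ℕ) (e : IExp)
  | setIArr (a : ℕ) (idx e : IExp)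
  | setRVar (r : ℕ) (e : RExp)
  | setRArr (a : ℕ) (idx : IExp) (e : RExp)
  | seq (p q : Prog)
  | ite (b : BExp) (p q : Prog)
  | loop (b : BExp) (p : Prog)

/-- Memory contents. -/
structure Mem (F : Type) where
  ivar : ℕ → ℤ
  iarr : ℕ → ℤ → ℤ
  rvar : ℕ → F
  rarr : ℕ → ℤ → F

/-- Binary length of an integer, with one bit for the sign. -/
def intSize (a : ℤ) : ℕ := Nat.size a.natAbs + 1

/-- Binary length of a rational number (numerator and denominator in lowest terms). -/
def ratSize (q : ℚ) : ℕ := intSize q.num + Nat.size q.den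

/-- In exact real arithmetic every real number counts as one unit. -/
def realSize (_ : ℝ) : ℕ := 1

section Semantics

variable {F : Type} [Ring F] [LinearOrder F]

def IExp.val (s : Mem F) : IExp → ℤ
  | .const c => c
  | .var r => s.ivar r
  | .arr a idx => s.iarr a (idx.val s)
  | .add e₁ e₂ => e₁.val s + e₂.val s
  | .sub e₁ e₂ => e₁.val s - e₂.val s
  | .mul e₁ e₂ => e₁.val s * e₂.val s

def IExp.cost (s : Mem F) : IExp → ℕ
  | .const c => 1 + intSize c
  | .var r => 1 + intSize (s.ivar r)
  | .arr a idx => idx.cost s + 1 + intSize (s.iarr a (idx.val s))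
  | .add e₁ e₂ => e₁.cost s + e₂.cost s + 1 + intSize (e₁.val s + e₂.val s)
  | .sub e₁ e₂ => e₁.cost s + e₂.cost s + 1 + intSize (e₁.val s - e₂.val s)
  | .mul e₁ e₂ => e₁.cost s + e₂.cost s + 1 + intSize (e₁.val s * e₂.val s)

def RExp.val (s : Mem F) : RExp → F
  | .ofInt e => (e.val s : F)
  | .var r => s.rvar r
  | .arr a idx => s.rarr a (idx.val s)
  | .add e₁ e₂ => e₁.val s + e₂.val s
  | .sub e₁ e₂ => e₁.val s - e₂.val s
  | .mul e₁ e₂ => e₁.val s * e₂.val s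

def RExp.cost (rs : F → ℕ) (s : Mem F) : RExp → ℕ
  | .ofInt e => e.cost s + 1 + rs (e.val s : F)
  | .var r => 1 + rs (s.rvar r)
  | .arr a idx => idx.cost s + 1 + rs (s.rarr a (idx.val s))
  | .add e₁ e₂ => e₁.cost rs s + e₂.cost rs s + 1 + rs (e₁.val s + e₂.val s)
  | .sub e₁ e₂ => e₁.cost rs s + e₂.cost rs s + 1 + rs (e₁.val s - e₂.val s)
  | .mul e₁ e₂ => e₁.cost rs s + e₂.cost rs s + 1 + rs (e₁.val s * e₂.val s)

def BExp.Holds (s : Mem F) : BExp → Prop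
  | .leI e₁ e₂ => e₁.val s ≤ e₂.val s
  | .leR e₁ e₂ => e₁.val s ≤ e₂.val s
  | .not b => ¬ b.Holds s
  | .and b₁ b₂ => b₁.Holds s ∧ b₂.Holds s

def BExp.cost (rs : F → ℕ) (s : Mem F) : BExp → ℕ
  | .leI e₁ e₂ => e₁.cost s + e₂.cost s + 1
  | .leR e₁ e₂ => e₁.cost rs s + e₂.cost rs s + 1
  | .not b => b.cost rs s + 1
  | .and b₁ b₂ => b₁.cost rs s + b₂.cost rs s + 1

/-- `Exec rs p s t s'`: started with memory `s`, the program `p` halts with memory `s'`, and the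
total cost of the computation is `t`. -/
inductive Exec (rs : F → ℕ) : Prog → Mem F → ℕ → Mem F → Prop
  | skip (s : Mem F) : Exec rs .skip s 1 s
  | setIVar (r : ℕ) (e : IExp) (s : Mem F) :
      Exec rs (.setIVar r e) s (e.cost s + 1)
        { s with ivar := Function.update s.ivar r (e.val s) }
  | setIArr (a : ℕ) (idx e : IExp) (s : Mem F) :
      Exec rs (.setIArr a idx e) s (idx.cost s + e.cost s + 1)
        { s with iarr := Function.update s.iarr a
                  (Function.update (s.iarr a) (idx.val s) (e.val s)) }
  | setRVar (r : ℕ) (e : RExp) (s : Mem F) :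
      Exec rs (.setRVar r e) s (e.cost rs s + 1)
        { s with rvar := Function.update s.rvar r (e.val s) }
  | setRArr (a : ℕ) (idx : IExp) (e : RExp) (s : Mem F) :
      Exec rs (.setRArr a idx e) s (idx.cost s + e.cost rs s + 1)
        { s with rarr := Function.update s.rarr a
                  (Function.update (s.rarr a) (idx.val s) (e.val s)) }
  | seq {p q : Prog} {s s₁ s₂ : Mem F} {t₁ t₂ : ℕ} :
      Exec rs p s t₁ s₁ → Exec rs q s₁ t₂ s₂ → Exec rs (.seq p q) s (t₁ + t₂) s₂
  | iteTrue {b : BExp} {p q : Prog} {s s₁ : Mem F} {t : ℕ} :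
      b.Holds s → Exec rs p s t s₁ → Exec rs (.ite b p q) s (b.cost rs s + 1 + t) s₁
  | iteFalse {b : BExp} {p q : Prog} {s s₁ : Mem F} {t : ℕ} :
      ¬ b.Holds s → Exec rs q s t s₁ → Exec rs (.ite b p q) s (b.cost rs s + 1 + t) s₁
  | loopDone {b : BExp} {p : Prog} {s : Mem F} :
      ¬ b.Holds s → Exec rs (.loop b p) s (b.cost rs s + 1) s
  | loopStep {b : BExp} {p : Prog} {s s₁ s₂ : Mem F} {t₁ t₂ : ℕ} :
      b.Holds s → Exec rs p s t₁ s₁ → Exec rs (.loop b p) s₁ t₂ s₂ →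
      Exec rs (.loop b p) s (b.cost rs s + 1 + t₁ + t₂) s₂

/-! ### Input and output conventions -/

/-- The array holding `v 0, …, v (n-1)` in the cells `0, …, n-1`, and `0` elsewhere. -/
def toArray {A : Type} [Zero A] {n : ℕ} (v : Fin n → A) (a : ℤ) : A :=
  if h : 0 ≤ a ∧ a < n then v ⟨a.toNat, by omega⟩ else 0

/-- The initial memory: integer registers `0` and `1` hold `n` and `w`, the integer arrays `0` and
`1` hold the category numbers (counted from one), the `F`-array `0` holds the coefficients `f`;
everything else is zero. (The parameter `w` is zero if there is no cardinality constraint.) -/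
def Inst.input {Kt Kh n : ℕ} (I : Inst F Kt Kh n) (w : ℕ) : Mem F where
  ivar r := if r = 0 then (n : ℤ) else if r = 1 then (w : ℤ) else 0
  iarr a := if a = 0 then toArray (fun i => ((I.catT i : ℕ) : ℤ) + 1)
    else if a = 1 then toArray (fun i => ((I.catH i : ℕ) : ℤ) + 1) else fun _ => 0
  rvar _ := 0
  rarr a := if a = 0 then toArray I.f else fun _ => 0

/-- The encoding length of the input. -/
def Inst.inputSize {Kt Kh n : ℕ} (rs : F → ℕ) (I : Inst F Kt Kh n) (w : ℕ) : ℕ :=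
  intSize n + intSize w +
    ∑ i, (intSize (((I.catT i : ℕ) : ℤ) + 1) + intSize (((I.catH i : ℕ) : ℤ) + 1) + rs (I.f i))

/-- The memory lists the solutions in `S`, each exactly once: their number is in integer register
`0`, and the `t`-th of them is in the cells `t n, …, t n + n - 1` of integer array `0`. -/
def ListsSolutions {n : ℕ} (s : Mem F) (S : Set (Sol n)) : Prop :=
  ∃ (N : ℕ) (L : Fin N → Sol n), Function.Injective L ∧ Set.range L = S ∧
    s.ivar 0 = N ∧ ∀ (t : Fin N) (i : Fin n), s.iarr 0 ((t : ℤ) * n + (i : ℤ)) = bit (L t) i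

/-- The memory lists the outcome vectors in `Z`, each exactly once: their number is in integer
register `1`, and the three parts of the `t`-th of them are in the cells `t Kt, …, t Kt + Kt - 1`
of integer array `1`, the cells `t Kh, …, t Kh + Kh - 1` of integer array `2`, and the cell `t` of
the `F`-array `0`. -/
def ListsOutcomes {Kt Kh : ℕ} (s : Mem F) (Z : Set (Outcome F Kt Kh)) : Prop :=
  ∃ (N : ℕ) (L : Fin N → Outcome F Kt Kh), Function.Injective L ∧ Set.range L = Z ∧
    s.ivar 1 = N ∧
    (∀ (t : Fin N) (j : Fin Kt), s.iarr 1 ((t : ℤ) * Kt + (j : ℤ)) = (L t).1 j) ∧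
    (∀ (t : Fin N) (j : Fin Kh), s.iarr 2 ((t : ℤ) * Kh + (j : ℤ)) = (L t).2.1 j) ∧
    (∀ t : Fin N, s.rarr 0 (t : ℤ) = (L t).2.2)

/-- The memory holds the nondominated set and a minimal complete set of `min z(x)`, `x ∈ X`. -/
def IsCorrectOutput {Kt Kh n : ℕ} (X : Set (Sol n)) (z : Sol n → Outcome F Kt Kh)
    (s : Mem F) : Prop :=
  ListsOutcomes s (nondominatedSet X z) ∧
    ∃ S : Set (Sol n), IsMinimalComplete X z S ∧ ListsSolutions s S

/-- On all instances of the unconstrained problem with coefficients in `F`, the program `P`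
computes the nondominated set and a minimal complete set, at a cost that is bounded by a
polynomial in the encoding length of the input. -/
def SolvesOMUCO (rs : F → ℕ) (Kt Kh : ℕ) (α β γ : ℤ) (P : Prog) : Prop :=
  ∃ p : Polynomial ℕ, ∀ (n : ℕ) (I : Inst F Kt Kh n),
    ∃ (t : ℕ) (s : Mem F), Exec rs P (I.input 0) t s ∧ t ≤ p.eval (I.inputSize rs 0) ∧
      IsCorrectOutput Set.univ (outcome α β γ I) s

/-- The same for the problem with the cardinality constraint `∑ i, x_i = w`, where
`w ∈ {0, …, n}` is part of the input. -/
def SolvesOMCOCC (rs : F → ℕ) (Kt Kh : ℕ) (α β γ : ℤ) (P : Prog) : Prop :=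
  ∃ p : Polynomial ℕ, ∀ (n : ℕ) (I : Inst F Kt Kh n) (w : ℕ), w ≤ n →
    ∃ (t : ℕ) (s : Mem F), Exec rs P (I.input w) t s ∧ t ≤ p.eval (I.inputSize rs w) ∧
      IsCorrectOutput (cardFeasible n w) (outcome α β γ I) s

end Semantics

end OrdMUCO

namespace OrdMUCO

/-! ### Size bounds -/

/-! The two counting vectors, together with the cardinality of a solution, form a vector of `Kt + Kh
+ 1` integers between `0` and `n`. For fixed numbers of categories there are only `(n + 1) ^ (Kt +
Kh + 1)` such vectors, polynomially many. Solutions with the same vector differ only in `γ f`, and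
the cardinality constraint depends on the vector alone. Hence it suffices to know one solution of
least `γ f` for each attainable vector: these representatives weakly dominate all feasible
solutions.

The representatives are found by a knapsack-like dynamic program. The vector is encoded in base `n +
1` as a single number, the key, which is additive: selecting a further element `k` adds `I.elemKey
k`. A best solution for key `q` among the first `k + 1` elements either avoids element `k`, or
arises by adding it to a best solution for key `q - I.elemKey k` among the first `k` (`RowOK.keep`,
`RowOK.take`). Pairwise comparison of the feasible rows, with ties broken in favour of the smaller
key, then leaves exactly one efficient solution per nondominated outcome (`nondominatedSet_eq`,
`isMinimalComplete_image`).

For the complexity, `Runs` separates the number of elementary steps, a polynomial in `n`, from the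
cost of one step, which is a constant depending on the program times a bound on the memory contents.
Integers stay polynomially bounded even in absolute value. Every stored element of `F` is a subset
sum of the coefficients, possibly times `γ`, and the length of a rational subset sum is linear in
the input length (`ratSize_sumObj_le`). The abstract bound `SizeBound` lets one argument serve both
exact real arithmetic and binary lengths of rationals. -/

theorem natSize_add_le (a b : ℕ) : Nat.size (a + b) ≤ max (Nat.size a) (Nat.size b) + 1 := by
  rw [Nat.size_le, pow_succ]
  have h1 : a < 2 ^ max (Nat.size a) (Nat.size b) :=
    (Nat.lt_size_self a).trans_le (Nat.pow_le_pow_right (by norm_num) (le_max_left _ _))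
  have h2 : b < 2 ^ max (Nat.size a) (Nat.size b) :=
    (Nat.lt_size_self b).trans_le (Nat.pow_le_pow_right (by norm_num) (le_max_right _ _))
  omega

theorem natSize_mul_le (a b : ℕ) : Nat.size (a * b) ≤ Nat.size a + Nat.size b := by
  rw [Nat.size_le, pow_add]
  exact Nat.mul_lt_mul'' (Nat.lt_size_self a) (Nat.lt_size_self b)

theorem natSize_le_self (a : ℕ) : Nat.size a ≤ a := by
  rw [Nat.size_le]
  exact Nat.lt_two_pow_self

theorem one_le_intSize (a : ℤ) : 1 ≤ intSize a := by unfold intSize; omega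

theorem intSize_le_of_abs_le {a : ℤ} {V : ℕ} (h : |a| ≤ V) : intSize a ≤ V + 1 := by
  unfold intSize
  have h₁ := natSize_le_self a.natAbs
  rw [Int.abs_eq_natAbs] at h
  omega

/-- The sharper bound is the maximum plus one. Since sizes are at least one, the sum is also a
bound, and it has the same form as the bound for products, so that all operations can be weighted
alike. -/
theorem intSize_add_le (a b : ℤ) : intSize (a + b) ≤ intSize a + intSize b := by
  unfold intSize
  have h1 := Nat.size_le_size (Int.natAbs_add_le a b)
  have h2 := natSize_add_le a.natAbs b.natAbs
  omega

theorem intSize_neg (a : ℤ) : intSize (-a) = intSize a := by simp [intSize]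

theorem intSize_sub_le (a b : ℤ) : intSize (a - b) ≤ intSize a + intSize b := by
  simpa [sub_eq_add_neg, intSize_neg] using intSize_add_le a (-b)

theorem intSize_mul_le (a b : ℤ) : intSize (a * b) ≤ intSize a + intSize b := by
  unfold intSize
  have := natSize_mul_le a.natAbs b.natAbs
  rw [Int.natAbs_mul]
  omega

section Memory

variable {F : Type}

/-- All memory contents have size at most `V`. -/
structure Mem.Bounded (rs : F → ℕ) (V : ℕ) (s : Mem F) : Prop where
  ivar_le : ∀ r, |s.ivar r| ≤ V
  iarr_le : ∀ a i, |s.iarr a i| ≤ V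
  rvar_le : ∀ r, rs (s.rvar r) ≤ V
  rarr_le : ∀ a i, rs (s.rarr a i) ≤ V

/-! ### Memory updates -/

def Mem.setI (s : Mem F) (r : ℕ) (v : ℤ) : Mem F :=
  { s with ivar := Function.update s.ivar r v }

def Mem.setIA (s : Mem F) (a : ℕ) (i v : ℤ) : Mem F :=
  { s with iarr := Function.update s.iarr a (Function.update (s.iarr a) i v) }

def Mem.setRA (s : Mem F) (a : ℕ) (i : ℤ) (v : F) : Mem F :=
  { s with rarr := Function.update s.rarr a (Function.update (s.rarr a) i v) }

section
variable (s : Mem F) (r a b : ℕ) (i j v : ℤ) (u : F)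

@[simp] theorem Mem.setI_ivar (r' : ℕ) :
    (s.setI r v).ivar r' = if r' = r then v else s.ivar r' := by
  simp [Mem.setI, Function.update_apply]
@[simp] theorem Mem.setI_iarr : (s.setI r v).iarr = s.iarr := rfl
@[simp] theorem Mem.setI_rarr : (s.setI r v).rarr = s.rarr := rfl

@[simp] theorem Mem.setIA_ivar : (s.setIA a i v).ivar = s.ivar := rfl
@[simp] theorem Mem.setIA_rarr : (s.setIA a i v).rarr = s.rarr := rfl
theorem Mem.setIA_iarr :
    (s.setIA a i v).iarr b j = if b = a ∧ j = i then v else s.iarr b j := by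
  by_cases h : b = a
  · subst h; simp [Mem.setIA, Function.update_apply]
  · simp [Mem.setIA, h]
theorem Mem.setIA_iarr_ne (h : b ≠ a) : (s.setIA a i v).iarr b = s.iarr b := by
  simp [Mem.setIA, Function.update_of_ne h]

@[simp] theorem Mem.setRA_ivar : (s.setRA a i u).ivar = s.ivar := rfl
@[simp] theorem Mem.setRA_iarr : (s.setRA a i u).iarr = s.iarr := rfl
theorem Mem.setRA_rarr :
    (s.setRA a i u).rarr b j = if b = a ∧ j = i then u else s.rarr b j := by
  by_cases h : b = a
  · subst h; simp [Mem.setRA, Function.update_apply]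
  · simp [Mem.setRA, h]
theorem Mem.setRA_rarr_ne (h : b ≠ a) : (s.setRA a i u).rarr b = s.rarr b := by
  simp [Mem.setRA, Function.update_of_ne h]

end

theorem Mem.Bounded.setI {rs : F → ℕ} {V : ℕ} {s : Mem F} (hs : s.Bounded rs V) (r : ℕ) {v : ℤ}
    (hv : |v| ≤ V) : (s.setI r v).Bounded rs V := by
  refine ⟨fun r' => ?_, hs.iarr_le, hs.rvar_le, hs.rarr_le⟩
  rw [Mem.setI_ivar]
  split_ifs
  exacts [hv, hs.ivar_le r']

theorem Mem.Bounded.setIA {rs : F → ℕ} {V : ℕ} {s : Mem F} (hs : s.Bounded rs V) (a : ℕ) (i : ℤ)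
    {v : ℤ} (hv : |v| ≤ V) : (s.setIA a i v).Bounded rs V := by
  refine ⟨hs.ivar_le, fun b j => ?_, hs.rvar_le, hs.rarr_le⟩
  rw [Mem.setIA_iarr]
  split_ifs
  exacts [hv, hs.iarr_le b j]

theorem Mem.Bounded.setRA {rs : F → ℕ} {V : ℕ} {s : Mem F} (hs : s.Bounded rs V) (a : ℕ) (i : ℤ)
    {v : F} (hv : rs v ≤ V) : (s.setRA a i v).Bounded rs V := by
  refine ⟨hs.ivar_le, hs.iarr_le, hs.rvar_le, fun b j => ?_⟩
  rw [Mem.setRA_rarr]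
  split_ifs
  exacts [hv, hs.rarr_le b j]

/-! ### Integer expressions -/

/-- The cost of an integer expression is at most its weight times the size of the memory
contents. -/
def IExp.wt : IExp → ℕ
  | .const c => 1 + intSize c
  | .var _ => 2
  | .arr _ idx => idx.wt + 2
  | .add e₁ e₂ => 2 * (e₁.wt + e₂.wt) + 1
  | .sub e₁ e₂ => 2 * (e₁.wt + e₂.wt) + 1
  | .mul e₁ e₂ => 2 * (e₁.wt + e₂.wt) + 1

/-- Value and cost need a joint induction: the cost of an operation includes the size of its result.
This is also the origin of the factor `2` in `IExp.wt`, one copy for the operands' costs and one for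
the result. -/
theorem IExp.size_val_cost_le {rs : F → ℕ} {V : ℕ} {s : Mem F} (hs : s.Bounded rs V) (e : IExp) :
    intSize (e.val s) ≤ e.wt * (V + 1) ∧ e.cost s ≤ e.wt * (V + 1) := by
  induction e with
  | const c =>
    simp only [IExp.val, IExp.cost, IExp.wt]
    constructor <;> nlinarith
  | var r =>
    have := intSize_le_of_abs_le (hs.ivar_le r)
    simp only [IExp.val, IExp.cost, IExp.wt]
    omega
  | arr a idx ih =>
    have := intSize_le_of_abs_le (hs.iarr_le a (idx.val s))
    simp only [IExp.val, IExp.cost, IExp.wt]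
    constructor <;> nlinarith
  | add e₁ e₂ ih₁ ih₂ =>
    have := intSize_add_le (e₁.val s) (e₂.val s)
    simp only [IExp.val, IExp.cost, IExp.wt]
    constructor <;> nlinarith
  | sub e₁ e₂ ih₁ ih₂ =>
    have := intSize_sub_le (e₁.val s) (e₂.val s)
    simp only [IExp.val, IExp.cost, IExp.wt]
    constructor <;> nlinarith
  | mul e₁ e₂ ih₁ ih₂ =>
    have := intSize_mul_le (e₁.val s) (e₂.val s)
    simp only [IExp.val, IExp.cost, IExp.wt]
    constructor <;> nlinarith

theorem IExp.cost_le {rs : F → ℕ} {V : ℕ} {s : Mem F} (hs : s.Bounded rs V) (e : IExp) :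
    e.cost s ≤ e.wt * (V + 1) :=
  (e.size_val_cost_le hs).2

end Memory

section RealExpressions

variable {F : Type} [Ring F]

/-- The size measure `rs` grows at most linearly under the arithmetic operations. -/
structure SizeBound (rs : F → ℕ) (C : ℕ) : Prop where
  add_le : ∀ a b, rs (a + b) ≤ C * (rs a + rs b)
  sub_le : ∀ a b, rs (a - b) ≤ C * (rs a + rs b)
  mul_le : ∀ a b, rs (a * b) ≤ C * (rs a + rs b)
  int_le : ∀ z : ℤ, rs (z : F) ≤ C * intSize z

/-! ### Static weights of expressions and programs -/

def RExp.wt (C : ℕ) : RExp → ℕ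
  | .ofInt e => e.wt + 1 + C * e.wt
  | .var _ => 2
  | .arr _ idx => idx.wt + 2
  | .add e₁ e₂ => (e₁.wt C + e₂.wt C) + 1 + C * (e₁.wt C + e₂.wt C)
  | .sub e₁ e₂ => (e₁.wt C + e₂.wt C) + 1 + C * (e₁.wt C + e₂.wt C)
  | .mul e₁ e₂ => (e₁.wt C + e₂.wt C) + 1 + C * (e₁.wt C + e₂.wt C)

def BExp.wt (C : ℕ) : BExp → ℕ
  | .leI e₁ e₂ => e₁.wt + e₂.wt + 1
  | .leR e₁ e₂ => e₁.wt C + e₂.wt C + 1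
  | .not b => b.wt C + 1
  | .and b₁ b₂ => b₁.wt C + b₂.wt C + 1

/-- The cost of an elementary step of a program is at most its weight times the size of the
memory contents. -/
def Prog.wt (C : ℕ) : Prog → ℕ
  | .skip => 1
  | .setIVar _ e => e.wt + 1
  | .setIArr _ idx e => idx.wt + e.wt + 1
  | .setRVar _ e => e.wt C + 1
  | .setRArr _ idx e => idx.wt + e.wt C + 1
  | .seq p q => p.wt C + q.wt C
  | .ite b p q => b.wt C + 1 + p.wt C + q.wt C
  | .loop b p => b.wt C + 1 + p.wt C

theorem RExp.size_val_cost_le {rs : F → ℕ} {C V : ℕ} {s : Mem F} (hC : SizeBound rs C)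
    (hs : s.Bounded rs V) (e : RExp) :
    rs (e.val s) ≤ e.wt C * (V + 1) ∧ e.cost rs s ≤ e.wt C * (V + 1) := by
  induction e with
  | ofInt e =>
    have h₁ := hC.int_le (e.val s)
    have h₂ := e.size_val_cost_le hs
    have h₃ := Nat.mul_le_mul_left C h₂.1
    simp only [RExp.val, RExp.cost, RExp.wt]
    constructor <;> nlinarith
  | var r =>
    have := hs.rvar_le r
    simp only [RExp.val, RExp.cost, RExp.wt]
    omega
  | arr a idx =>
    have h₁ := hs.rarr_le a (idx.val s)
    have h₂ := idx.cost_le hs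
    simp only [RExp.val, RExp.cost, RExp.wt]
    constructor <;> nlinarith
  | add e₁ e₂ ih₁ ih₂ =>
    have h₁ := hC.add_le (e₁.val s) (e₂.val s)
    have h₂ := Nat.mul_le_mul_left C (Nat.add_le_add ih₁.1 ih₂.1)
    simp only [RExp.val, RExp.cost, RExp.wt]
    constructor <;> nlinarith
  | sub e₁ e₂ ih₁ ih₂ =>
    have h₁ := hC.sub_le (e₁.val s) (e₂.val s)
    have h₂ := Nat.mul_le_mul_left C (Nat.add_le_add ih₁.1 ih₂.1)
    simp only [RExp.val, RExp.cost, RExp.wt]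
    constructor <;> nlinarith
  | mul e₁ e₂ ih₁ ih₂ =>
    have h₁ := hC.mul_le (e₁.val s) (e₂.val s)
    have h₂ := Nat.mul_le_mul_left C (Nat.add_le_add ih₁.1 ih₂.1)
    simp only [RExp.val, RExp.cost, RExp.wt]
    constructor <;> nlinarith

theorem RExp.cost_le {rs : F → ℕ} {C V : ℕ} {s : Mem F} (hC : SizeBound rs C)
    (hs : s.Bounded rs V) (e : RExp) : e.cost rs s ≤ e.wt C * (V + 1) :=
  (e.size_val_cost_le hC hs).2

theorem BExp.cost_le {rs : F → ℕ} {C V : ℕ} {s : Mem F} (hC : SizeBound rs C)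
    (hs : s.Bounded rs V) (b : BExp) : b.cost rs s ≤ b.wt C * (V + 1) := by
  induction b with
  | leI e₁ e₂ =>
    have h₁ := e₁.cost_le hs
    have h₂ := e₂.cost_le hs
    simp only [BExp.cost, BExp.wt]
    nlinarith
  | leR e₁ e₂ =>
    have h₁ := e₁.cost_le hC hs
    have h₂ := e₂.cost_le hC hs
    simp only [BExp.cost, BExp.wt]
    nlinarith
  | not b ih =>
    simp only [BExp.cost, BExp.wt]
    nlinarith
  | and b₁ b₂ ih₁ ih₂ =>
    simp only [BExp.cost, BExp.wt]
    nlinarith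

end RealExpressions

section Machine

variable {F : Type} [Ring F] [LinearOrder F]

/-! ### Program logic -/

/-- Started with memory `s`, the program `P` halts after at most `T` elementary steps, each of
cost at most `P.wt C * (V + 1)`, with a memory that satisfies `Q`. -/
def Runs (rs : F → ℕ) (C V : ℕ) (P : Prog) (T : ℕ) (s : Mem F) (Q : Mem F → Prop) : Prop :=
  ∃ t s', Exec rs P s t s' ∧ t ≤ P.wt C * (V + 1) * T ∧ Q s'

variable {rs : F → ℕ} {C V : ℕ} {s : Mem F} {Q : Mem F → Prop}

theorem Runs.imp {P : Prog} {T T' : ℕ} {Q' : Mem F → Prop} (h : Runs rs C V P T s Q) (hT : T ≤ T')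
    (hQ : ∀ s', Q s' → Q' s') : Runs rs C V P T' s Q' := by
  obtain ⟨t, s', h₁, h₂, h₃⟩ := h
  exact ⟨t, s', h₁, h₂.trans (Nat.mul_le_mul_left _ hT), hQ _ h₃⟩

theorem Runs.skip (h : Q s) : Runs rs C V .skip 1 s Q :=
  ⟨_, _, .skip s, by simp [Prog.wt], h⟩

theorem Runs.setIVar {r : ℕ} {e : IExp} (hs : s.Bounded rs V) (h : Q (s.setI r (e.val s))) :
    Runs rs C V (.setIVar r e) 1 s Q := by
  refine ⟨_, _, .setIVar r e s, ?_, h⟩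
  have := e.cost_le hs
  simp only [Prog.wt]
  nlinarith

theorem Runs.setIArr {a : ℕ} {idx e : IExp} (hs : s.Bounded rs V)
    (h : Q (s.setIA a (idx.val s) (e.val s))) : Runs rs C V (.setIArr a idx e) 1 s Q := by
  refine ⟨_, _, .setIArr a idx e s, ?_, h⟩
  have := e.cost_le hs
  have := idx.cost_le hs
  simp only [Prog.wt]
  nlinarith

theorem Runs.setRArr {a : ℕ} {idx : IExp} {e : RExp} (hC : SizeBound rs C) (hs : s.Bounded rs V)
    (h : Q (s.setRA a (idx.val s) (e.val s))) : Runs rs C V (.setRArr a idx e) 1 s Q := by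
  refine ⟨_, _, .setRArr a idx e s, ?_, h⟩
  have := e.cost_le hC hs
  have := idx.cost_le hs
  simp only [Prog.wt]
  nlinarith

/-- The postcondition of `p` is the run of `q`, so a program is verified by executing it
symbolically from left to right. Step counts add because the weight of the composition bounds both
weights. -/
theorem Runs.seq {p q : Prog} {T₁ T₂ : ℕ}
    (h : Runs rs C V p T₁ s fun s' => Runs rs C V q T₂ s' Q) :
    Runs rs C V (.seq p q) (T₁ + T₂) s Q := by
  obtain ⟨t₁, s₁, h₁, ht₁, t₂, s₂, h₂, ht₂, hQ⟩ := h
  refine ⟨_, _, .seq h₁ h₂, ?_, hQ⟩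
  simp only [Prog.wt]
  calc t₁ + t₂ ≤ p.wt C * (V + 1) * T₁ + q.wt C * (V + 1) * T₂ := Nat.add_le_add ht₁ ht₂
    _ ≤ (p.wt C + q.wt C) * (V + 1) * T₁ + (p.wt C + q.wt C) * (V + 1) * T₂ := by
      gcongr <;> omega
    _ = _ := by ring

theorem Runs.ite {b : BExp} {p q : Prog} {T : ℕ} (hC : SizeBound rs C) (hs : s.Bounded rs V)
    (hp : b.Holds s → Runs rs C V p T s Q) (hq : ¬ b.Holds s → Runs rs C V q T s Q) :
    Runs rs C V (.ite b p q) (T + 1) s Q := by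
  have hb := b.cost_le hC hs
  -- Common estimate for both branches, with `W` the weight of the branch taken.
  have key : ∀ t W, t ≤ W * (V + 1) * T → W ≤ p.wt C + q.wt C →
      b.cost rs s + 1 + t ≤ (b.wt C + 1 + p.wt C + q.wt C) * (V + 1) * (T + 1) := by
    intro t W ht hW
    calc b.cost rs s + 1 + t ≤ (b.wt C + 1) * (V + 1) * 1 + (p.wt C + q.wt C) * (V + 1) * T := by
          have : W * (V + 1) * T ≤ (p.wt C + q.wt C) * (V + 1) * T := by gcongr
          nlinarith
      _ ≤ (b.wt C + 1 + p.wt C + q.wt C) * (V + 1) * 1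
          + (b.wt C + 1 + p.wt C + q.wt C) * (V + 1) * T :=
        Nat.add_le_add (Nat.mul_le_mul_right _ (Nat.mul_le_mul_right _ (by omega)))
          (Nat.mul_le_mul_right _ (Nat.mul_le_mul_right _ (by omega)))
      _ = _ := by ring
  by_cases h : b.Holds s
  · obtain ⟨t, s', h₁, h₂, h₃⟩ := hp h
    exact ⟨_, _, .iteTrue h h₁, key t _ h₂ (by omega), h₃⟩
  · obtain ⟨t, s', h₁, h₂, h₃⟩ := hq h
    exact ⟨_, _, .iteFalse h h₁, key t _ h₂ (by omega), h₃⟩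

theorem Runs.loop_done {b : BExp} {p : Prog} (hC : SizeBound rs C) (hs : s.Bounded rs V)
    (h : ¬ b.Holds s) (hQ : Q s) : Runs rs C V (.loop b p) 1 s Q := by
  have hb := b.cost_le hC hs
  refine ⟨_, _, .loopDone h, ?_, hQ⟩
  simp only [Prog.wt]
  nlinarith

theorem Runs.loop_step {b : BExp} {p : Prog} {T T' : ℕ} (hC : SizeBound rs C)
    (hs : s.Bounded rs V) (h : b.Holds s)
    (hp : Runs rs C V p T s fun s' => Runs rs C V (.loop b p) T' s' Q) :
    Runs rs C V (.loop b p) (T + 1 + T') s Q := by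
  have hb := b.cost_le hC hs
  obtain ⟨t₁, s₁, h₁, ht₁, t₂, s₂, h₂, ht₂, hQ⟩ := hp
  refine ⟨_, _, .loopStep h h₁ h₂, ?_, hQ⟩
  simp only [Prog.wt] at ht₂ ⊢
  calc b.cost rs s + 1 + t₁ + t₂
      ≤ (b.wt C + 1) * (V + 1) * 1 + p.wt C * (V + 1) * T
        + (b.wt C + 1 + p.wt C) * (V + 1) * T' := by nlinarith
    _ ≤ (b.wt C + 1 + p.wt C) * (V + 1) * 1 + (b.wt C + 1 + p.wt C) * (V + 1) * T
        + (b.wt C + 1 + p.wt C) * (V + 1) * T' :=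
        Nat.add_le_add_right (Nat.add_le_add
          (Nat.mul_le_mul_right _ (Nat.mul_le_mul_right _ (by omega)))
          (Nat.mul_le_mul_right _ (Nat.mul_le_mul_right _ (by omega)))) _
    _ = _ := by ring

/-- `for r = 0, …, bnd - 1 do body`. -/
def forUp (r : ℕ) (bnd : IExp) (body : Prog) : Prog :=
  .seq (.setIVar r (.const 0)) (.loop (.not (.leI bnd (.var r)))
    (.seq body (.setIVar r (.add (.var r) (.const 1)))))

/-- `Inv k` refers to the memory in which the counter already equals `k`. The body must preserve the
counter, and `Inv (k + 1)` is required only after the increment. Each round costs the `T` steps of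
the body, one increment and one test; initialization and the final test give the two extra units. -/
theorem Runs.forUp {r : ℕ} {bnd : IExp} {body : Prog} {T : ℕ} (N : ℕ) (Inv : ℕ → Mem F → Prop)
    (hC : SizeBound rs C) (hs : s.Bounded rs V) (h₀ : Inv 0 (s.setI r 0))
    (hInv : ∀ k s, k ≤ N → Inv k s → s.Bounded rs V ∧ s.ivar r = k ∧ bnd.val s = N)
    (hbody : ∀ k s, k < N → Inv k s → Runs rs C V body T s fun s' =>
      s'.Bounded rs V ∧ s'.ivar r = k ∧ Inv (k + 1) (s'.setI r (k + 1)))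
    (hQ : ∀ s, Inv N s → Q s) :
    Runs rs C V (OrdMUCO.forUp r bnd body) (1 + (N * (T + 2) + 1)) s Q := by
  refine .seq (.setIVar hs ?_)
  -- Induction on the number `m` of remaining rounds.
  have main : ∀ m k s, k + m = N → Inv k s →
      Runs rs C V (.loop (.not (.leI bnd (.var r)))
        (.seq body (.setIVar r (.add (.var r) (.const 1))))) (m * (T + 2) + 1) s Q := by
    intro m
    induction m with
    | zero =>
      intro k s hk hI
      obtain ⟨h₁, h₂, h₃⟩ := hInv k s (by omega) hI
      obtain rfl : k = N := by omega
      refine (Runs.loop_done hC h₁ ?_ (hQ s hI)).imp (by omega) fun _ h => h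
      simp [BExp.Holds, IExp.val, h₂, h₃]
    | succ m ih =>
      intro k s hk hI
      obtain ⟨h₁, h₂, h₃⟩ := hInv k s (by omega) hI
      have : (m + 1) * (T + 2) + 1 = (T + 1) + 1 + (m * (T + 2) + 1) := by ring
      rw [this]
      refine .loop_step hC h₁ ?_ (.seq ((hbody k s (by omega) hI).imp le_rfl ?_))
      · simp [BExp.Holds, IExp.val, h₂, h₃]
        omega
      · rintro s' ⟨h₄, h₅, h₆⟩
        refine .setIVar h₄ (ih (k + 1) _ (by omega) ?_)
        simpa [IExp.val, h₅] using h₆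
  exact main N 0 _ (by omega) h₀

/-- `f 0; …; f (m - 1)`. -/
def seqRange (f : ℕ → Prog) : ℕ → Prog
  | 0 => .skip
  | m + 1 => .seq (seqRange f m) (f m)

/-- Register and array names are part of the program text and cannot be computed, so a loop over
components has to be unrolled. The extra unit pays for the initial `skip`. -/
theorem Runs.seqRange {f : ℕ → Prog} {T : ℕ} (m : ℕ) (Inv : ℕ → Mem F → Prop) (h₀ : Inv 0 s)
    (hf : ∀ j s, j < m → Inv j s → Runs rs C V (f j) T s (Inv (j + 1)))
    (hQ : ∀ s, Inv m s → Q s) :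
    Runs rs C V (OrdMUCO.seqRange f m) (1 + m * T) s Q := by
  have main : ∀ j ≤ m, Runs rs C V (OrdMUCO.seqRange f j) (1 + j * T) s (Inv j) := by
    intro j
    induction j with
    | zero => intro _; exact (Runs.skip h₀).imp (by omega) fun _ h => h
    | succ j ih =>
      intro hj
      rw [show 1 + (j + 1) * T = (1 + j * T) + T by ring]
      exact .seq ((ih (by omega)).imp le_rfl fun s' h => hf j s' (by omega) h)
  exact (main m le_rfl).imp le_rfl hQ

end Machine

/-! ### Components and keys of solutions -/

section Keys

variable {F : Type} [Ring F] [LinearOrder F] {Kt Kh n : ℕ}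

theorem bit_nonneg (x : Sol n) (i : Fin n) : 0 ≤ bit x i := by unfold bit; split_ifs <;> simp

theorem bit_le_one (x : Sol n) (i : Fin n) : bit x i ≤ 1 := by unfold bit; split_ifs <;> simp

theorem bit_update_true (x : Sol n) (k i : Fin n) :
    bit (Function.update x k true) i = if i = k then 1 else bit x i := by
  by_cases h : i = k
  · subst h; simp [bit]
  · simp [bit, h]

theorem sum_mul_bit_update {R : Type} [Ring R] (g : Fin n → R) {x : Sol n} {k : Fin n}
    (hk : x k = false) :
    ∑ i, g i * (bit (Function.update x k true) i : R) = ∑ i, g i * (bit x i : R) + g k := by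
  have : ∀ i, g i * (bit (Function.update x k true) i : R) =
      g i * (bit x i : R) + if i = k then g k else 0 := by
    intro i
    rw [bit_update_true]
    by_cases h : i = k
    · subst h; simp [bit, hk]
    · simp [h]
  simp [this, Finset.sum_add_distrib]

theorem sumObj_update {F : Type} [Ring F] (f : Fin n → F) {x : Sol n} {k : Fin n} (hk : x k = false) :
    sumObj f (Function.update x k true) = sumObj f x + f k :=
  sum_mul_bit_update f hk

theorem sumObj_false {F : Type} [Ring F] (f : Fin n → F) : sumObj f (fun _ => false) = 0 := by
  simp [sumObj, bit]

/-- The contribution of element `i` to component `j`: the components are the two incremental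
counting vectors and the cardinality. -/
def Inst.entry (I : Inst F Kt Kh n) (i : Fin n) (j : ℕ) : ℤ :=
  if j < Kt then (if j ≤ (I.catT i : ℕ) then 1 else 0)
  else if j < Kt + Kh then (if j - Kt ≤ (I.catH i : ℕ) then 1 else 0) else 1

def Inst.comp (I : Inst F Kt Kh n) (x : Sol n) (j : ℕ) : ℤ := ∑ i, I.entry i j * bit x i

/-- The vector of components, encoded as a number. -/
def Inst.key (I : Inst F Kt Kh n) (x : Sol n) : ℤ :=
  ∑ j ∈ Finset.range (Kt + Kh + 1), I.comp x j * ((n : ℤ) + 1) ^ j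

def Inst.elemKey (I : Inst F Kt Kh n) (i : Fin n) : ℤ :=
  ∑ j ∈ Finset.range (Kt + Kh + 1), I.entry i j * ((n : ℤ) + 1) ^ j

variable (I : Inst F Kt Kh n)

theorem Inst.entry_mem (i : Fin n) (j : ℕ) : I.entry i j = 0 ∨ I.entry i j = 1 := by
  unfold Inst.entry; split_ifs <;> simp

theorem Inst.entry_nonneg (i : Fin n) (j : ℕ) : 0 ≤ I.entry i j := by
  rcases I.entry_mem i j with h | h <;> simp [h]

theorem Inst.comp_update {x : Sol n} {k : Fin n} (hk : x k = false) (j : ℕ) :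
    I.comp (Function.update x k true) j = I.comp x j + I.entry k j := by
  simpa [Inst.comp] using sum_mul_bit_update (fun i => I.entry i j) hk

theorem Inst.key_update {x : Sol n} {k : Fin n} (hk : x k = false) :
    I.key (Function.update x k true) = I.key x + I.elemKey k := by
  simp [Inst.key, Inst.elemKey, I.comp_update hk, add_mul, Finset.sum_add_distrib]

theorem Inst.comp_false (j : ℕ) : I.comp (fun _ => false) j = 0 := by simp [Inst.comp, bit]

theorem Inst.key_false : I.key (fun _ => false) = 0 := by simp [Inst.key, I.comp_false]

theorem Inst.comp_nonneg (x : Sol n) (j : ℕ) : 0 ≤ I.comp x j :=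
  Finset.sum_nonneg fun i _ => mul_nonneg (I.entry_nonneg i j) (bit_nonneg x i)

theorem Inst.comp_le (x : Sol n) (j : ℕ) : I.comp x j ≤ n := by
  calc I.comp x j ≤ ∑ _i : Fin n, (1 : ℤ) := by
        refine Finset.sum_le_sum fun i _ => ?_
        have h₁ := bit_nonneg x i
        have h₂ := bit_le_one x i
        rcases I.entry_mem i j with h | h <;> simp [h, h₂]
    _ = n := by simp

/-- The cardinality component of every element is `1`, which contributes `(n + 1) ^ (Kt + Kh)`.
Adding an element therefore strictly increases the key, which is what permits updating the table in
place. This is one reason to keep the cardinality in the key even without the constraint. -/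
theorem Inst.one_le_elemKey (i : Fin n) : 1 ≤ I.elemKey i := by
  have h := Finset.single_le_sum
    (f := fun j => I.entry i j * ((n : ℤ) + 1) ^ j) (s := Finset.range (Kt + Kh + 1))
    (fun j _ => mul_nonneg (I.entry_nonneg i j) (by positivity))
    (Finset.mem_range.2 (Nat.lt_succ_self (Kt + Kh)))
  have h₁ : I.entry i (Kt + Kh) = 1 := by simp [Inst.entry]
  have h₂ : (1 : ℤ) ≤ ((n : ℤ) + 1) ^ (Kt + Kh) := one_le_pow₀ (by omega)
  simp only [h₁, one_mul] at h
  exact h₂.trans h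

/-- The component vector with entries in `Fin (n + 1)`. -/
def Inst.digits (x : Sol n) (j : Fin (Kt + Kh + 1)) : Fin (n + 1) :=
  ⟨(I.comp x j).toNat, by have := I.comp_le x j; omega⟩

/-- All components lie between `0` and `n`, so the key is a genuine base `n + 1` expansion. Range
and injectivity of the encoding follow from the equivalence `finFunctionFinEquiv`. -/
theorem Inst.key_eq_digits (x : Sol n) : I.key x = (finFunctionFinEquiv (I.digits x) : ℕ) := by
  rw [finFunctionFinEquiv_apply, Inst.key, Finset.sum_range]
  push_cast
  refine Finset.sum_congr rfl fun j _ => ?_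
  have := I.comp_nonneg x j
  simp [Inst.digits, this]

theorem Inst.key_nonneg (x : Sol n) : 0 ≤ I.key x := by rw [I.key_eq_digits]; positivity

theorem Inst.key_lt (x : Sol n) : I.key x < ((n : ℤ) + 1) ^ (Kt + Kh + 1) := by
  rw [I.key_eq_digits]
  exact_mod_cast (finFunctionFinEquiv (I.digits x)).2

theorem Inst.comp_eq_of_key_eq {x y : Sol n} (h : I.key x = I.key y) {j : ℕ}
    (hj : j < Kt + Kh + 1) : I.comp x j = I.comp y j := by
  rw [I.key_eq_digits, I.key_eq_digits, Nat.cast_inj, Fin.val_inj, EmbeddingLike.apply_eq_iff_eq]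
    at h
  have h₁ := congrArg Fin.val (congrFun h ⟨j, hj⟩)
  have h₂ := I.comp_nonneg x j
  have h₃ := I.comp_nonneg y j
  simp only [Inst.digits] at h₁
  omega

theorem Inst.elemKey_lt (i : Fin n) : I.elemKey i < ((n : ℤ) + 1) ^ (Kt + Kh + 1) := by
  have h := I.key_update (x := fun _ => false) (k := i) rfl
  rw [I.key_false, zero_add] at h
  rw [← h]
  exact I.key_lt _

theorem Inst.countVec_catT (x : Sol n) (j : Fin Kt) : countVec I.catT x j = I.comp x j := by
  unfold countVec Inst.comp
  refine Finset.sum_congr rfl fun i _ => ?_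
  simp only [costEntry, Inst.entry, Fin.le_def, j.2, if_true]

theorem Inst.countVec_catH (x : Sol n) (j : Fin Kh) : countVec I.catH x j = I.comp x (Kt + j) := by
  unfold countVec Inst.comp
  refine Finset.sum_congr rfl fun i _ => ?_
  have h₁ : ¬ Kt + (j : ℕ) < Kt := by omega
  have h₂ : Kt + (j : ℕ) < Kt + Kh := by omega
  simp only [costEntry, Inst.entry, Fin.le_def, h₁, h₂, if_true, if_false, Nat.add_sub_cancel_left]

theorem Inst.sum_bit (x : Sol n) : ∑ i, bit x i = I.comp x (Kt + Kh) := by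
  simp [Inst.comp, Inst.entry]

end Keys

/-! ### Selecting a minimal complete set from a finite family -/

section Selection

variable {F : Type} [LinearOrder F] {Kt Kh n : ℕ}

/-- The outcome with index `q'` is a reason to discard the one with index `q`. -/
def Beats (Z : ℕ → Outcome F Kt Kh) (q' q : ℕ) : Prop :=
  Z q' ≤ Z q ∧ ¬ (Z q ≤ Z q' ∧ q ≤ q')

def Kept (A : Set ℕ) (Z : ℕ → Outcome F Kt Kh) (q : ℕ) : Prop :=
  q ∈ A ∧ ∀ q' ∈ A, ¬ Beats Z q' q

/-- For equal outcomes, `Beats Z q' q` reduces to `q' < q`, so the larger of two distinct indices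
would be discarded. -/
theorem Kept.eq_of_eq {A : Set ℕ} {Z : ℕ → Outcome F Kt Kh} {q q' : ℕ} (hq : Kept A Z q)
    (hq' : Kept A Z q') (h : Z q = Z q') : q = q' := by
  have h₁ := hq.2 q' hq'.1
  have h₂ := hq'.2 q hq.1
  simp only [Beats, h, le_refl, true_and, not_not] at h₁ h₂
  omega

open Classical in
/-- The first `q` keys, restricted to those that are kept. -/
noncomputable def keptBelow (A : Set ℕ) (Z : ℕ → Outcome F Kt Kh) (q : ℕ) : List ℕ :=
  (List.range q).filter fun q => decide (Kept A Z q)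

theorem keptBelow_succ (A : Set ℕ) (Z : ℕ → Outcome F Kt Kh) (q : ℕ) [Decidable (Kept A Z q)] :
    keptBelow A Z (q + 1) = keptBelow A Z q ++ if Kept A Z q then [q] else [] := by
  simp only [keptBelow, List.range_succ, List.filter_append]
  congr 1
  by_cases h : Kept A Z q <;> simp [h]

theorem mem_keptBelow {A : Set ℕ} {Z : ℕ → Outcome F Kt Kh} {M q : ℕ} :
    q ∈ keptBelow A Z M ↔ q < M ∧ Kept A Z q := by
  simp [keptBelow]

theorem keptBelow_nodup (A : Set ℕ) (Z : ℕ → Outcome F Kt Kh) (M : ℕ) :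
    (keptBelow A Z M).Nodup :=
  List.nodup_range.filter _

variable {X : Set (Sol n)} {z : Sol n → Outcome F Kt Kh} {A : Set ℕ} {x : ℕ → Sol n}

/-- If a feasible `y` dominated `x q`, a representative `x q'` of `y` would satisfy `z (x q') ≤ z y
≤ z (x q)`. It beats `q`, since `z (x q) ≤ z (x q')` would force `z y = z (x q)`. -/
theorem mem_efficientSet_of_kept (hx : ∀ y ∈ X, ∃ q ∈ A, z (x q) ≤ z y) (hA : ∀ q ∈ A, x q ∈ X)
    {q : ℕ} (hq : Kept A (fun q => z (x q)) q) : x q ∈ efficientSet X z := by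
  refine ⟨hA q hq.1, ?_⟩
  rintro ⟨y, hy, hle, hne⟩
  obtain ⟨q', hq', h⟩ := hx y hy
  refine hq.2 q' hq' ⟨h.trans hle, fun h' => hne ?_⟩
  exact le_antisymm hle (h'.1.trans h)

/-- The witness is the least index in `A` with outcome `v`. Anything that beats it has outcome at
most `v`, hence equal to `v` by efficiency, and then a smaller index, contradicting minimality. -/
theorem exists_kept (hx : ∀ y ∈ X, ∃ q ∈ A, z (x q) ≤ z y) (hA : ∀ q ∈ A, x q ∈ X)
    {v : Outcome F Kt Kh} (hv : v ∈ nondominatedSet X z) :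
    ∃ q, Kept A (fun q => z (x q)) q ∧ z (x q) = v := by
  classical
  obtain ⟨y, ⟨hy, hyeff⟩, rfl⟩ := hv
  have hmin : ∀ q ∈ A, z (x q) ≤ z y → z (x q) = z y := fun q hq h => by
    by_contra hne
    exact hyeff ⟨x q, hA q hq, h, hne⟩
  have hex : ∃ q, q ∈ A ∧ z (x q) = z y := by
    obtain ⟨q, hq, h⟩ := hx y hy
    exact ⟨q, hq, hmin q hq h⟩
  refine ⟨Nat.find hex, ⟨(Nat.find_spec hex).1, fun q' hq' hb => ?_⟩, (Nat.find_spec hex).2⟩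
  have h₁ : z (x (Nat.find hex)) = z y := (Nat.find_spec hex).2
  have h₂ := hmin q' hq' (h₁ ▸ hb.1)
  exact hb.2 ⟨(h₁.trans h₂.symm).le, Nat.find_min' hex ⟨hq', h₂⟩⟩

theorem nondominatedSet_eq (hx : ∀ y ∈ X, ∃ q ∈ A, z (x q) ≤ z y) (hA : ∀ q ∈ A, x q ∈ X) :
    nondominatedSet X z = (fun q => z (x q)) '' {q | Kept A (fun q => z (x q)) q} := by
  ext v
  constructor
  · intro hv
    exact exists_kept hx hA hv
  · rintro ⟨q, hq, rfl⟩
    exact ⟨x q, mem_efficientSet_of_kept hx hA hq, rfl⟩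

theorem isMinimalComplete_image (hx : ∀ y ∈ X, ∃ q ∈ A, z (x q) ≤ z y) (hA : ∀ q ∈ A, x q ∈ X) :
    IsMinimalComplete X z (x '' {q | Kept A (fun q => z (x q)) q}) := by
  constructor
  · rintro _ ⟨q, hq, rfl⟩
    exact mem_efficientSet_of_kept hx hA hq
  · intro v hv
    obtain ⟨q, hq, rfl⟩ := exists_kept hx hA hv
    refine ⟨x q, ⟨⟨q, hq, rfl⟩, rfl⟩, ?_⟩
    rintro _ ⟨⟨q', hq', rfl⟩, h⟩
    rw [Kept.eq_of_eq hq' hq h]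

end Selection

/-! ### The two size measures -/

theorem sizeBound_realSize : SizeBound realSize 1 where
  add_le _ _ := by simp [realSize]
  sub_le _ _ := by simp [realSize]
  mul_le _ _ := by simp [realSize]
  int_le z := by simpa [realSize] using one_le_intSize z

theorem intSize_mono {a b : ℤ} (h : a.natAbs ≤ b.natAbs) : intSize a ≤ intSize b := by
  unfold intSize
  have := Nat.size_le_size h
  omega

theorem ratSize_neg (q : ℚ) : ratSize (-q) = ratSize q := by simp [ratSize, intSize_neg]

/-- A fraction is not shorter than the rational number it represents. -/
theorem ratSize_le_of_eq_div {q : ℚ} {a : ℤ} {b : ℕ} (hb : b ≠ 0) (h : q = a / b) :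
    ratSize q ≤ intSize a + Nat.size b := by
  have h₁ : q = Rat.divInt a b := by rw [h, Rat.divInt_eq_div]; simp
  have hden : q.den ∣ b := by
    have := Rat.den_dvd a b
    rw [← h₁] at this
    exact_mod_cast this
  have hnum : q.num.natAbs ≤ a.natAbs := by
    by_cases ha : a = 0
    · simp [h, ha]
    · have := Rat.num_dvd a (b := (b : ℤ)) (by exact_mod_cast hb)
      rw [← h₁] at this
      exact Nat.le_of_dvd (by omega) (Int.natAbs_dvd_natAbs.2 this)
  exact Nat.add_le_add (intSize_mono hnum) (Nat.size_le_size (Nat.le_of_dvd (by omega) hden))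

theorem one_le_size_den (q : ℚ) : 1 ≤ Nat.size q.den := Nat.size_pos.2 q.den_pos

theorem intSize_natCast (b : ℕ) : intSize b = Nat.size b + 1 := by simp [intSize]

/-- In the cross-multiplied fraction each denominator occurs once in the numerator and once in the
denominator, whence the factor `2`. -/
theorem ratSize_add_le (p q : ℚ) : ratSize (p + q) ≤ 2 * (ratSize p + ratSize q) := by
  have h : p + q = ((p.num * q.den + q.num * p.den : ℤ) : ℚ) / ((p.den * q.den : ℕ) : ℚ) := by
    have h₁ : (p.den : ℚ) ≠ 0 := by exact_mod_cast p.den_nz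
    have h₂ : (q.den : ℚ) ≠ 0 := by exact_mod_cast q.den_nz
    conv_lhs => rw [← Rat.num_div_den p, ← Rat.num_div_den q]
    push_cast
    field_simp
  have h₁ := ratSize_le_of_eq_div (Nat.mul_ne_zero p.den_nz q.den_nz) h
  have h₂ := intSize_add_le (p.num * q.den) (q.num * p.den)
  have h₃ := intSize_mul_le p.num q.den
  have h₄ := intSize_mul_le q.num p.den
  have h₅ := natSize_mul_le p.den q.den
  have h₆ := one_le_intSize p.num
  have h₇ := one_le_intSize q.num
  rw [intSize_natCast] at h₃ h₄
  unfold ratSize at *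
  omega

theorem ratSize_mul_le (p q : ℚ) : ratSize (p * q) ≤ 2 * (ratSize p + ratSize q) := by
  have h : p * q = ((p.num * q.num : ℤ) : ℚ) / ((p.den * q.den : ℕ) : ℚ) := by
    conv_lhs => rw [← Rat.num_div_den p, ← Rat.num_div_den q]
    push_cast
    rw [div_mul_div_comm]
  have h₁ := ratSize_le_of_eq_div (Nat.mul_ne_zero p.den_nz q.den_nz) h
  have h₂ := intSize_mul_le p.num q.num
  have h₅ := natSize_mul_le p.den q.den
  unfold ratSize at *
  omega

theorem sizeBound_ratSize : SizeBound ratSize 2 where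
  add_le := ratSize_add_le
  sub_le p q := by simpa [sub_eq_add_neg, ratSize_neg] using ratSize_add_le p (-q)
  mul_le := ratSize_mul_le
  int_le z := by
    have := one_le_intSize z
    simp [ratSize]
    omega

theorem intSize_add_le_max (a b : ℤ) : intSize (a + b) ≤ max (intSize a) (intSize b) + 1 := by
  unfold intSize
  have h₁ := Nat.size_le_size (Int.natAbs_add_le a b)
  have h₂ := natSize_add_le a.natAbs b.natAbs
  omega

theorem intSize_mul_natCast_le (a : ℤ) (b : ℕ) : intSize (a * b) ≤ intSize a + Nat.size b := by
  unfold intSize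
  have := natSize_mul_le a.natAbs b
  simp only [Int.natAbs_mul, Int.natAbs_natCast]
  omega

/-- A finite sum can be written as a fraction that is not much longer than all summands
together. -/
theorem exists_sum_eq_div {ι : Type} (s : Finset ι) (g : ι → ℚ) :
    ∃ (a : ℤ) (b : ℕ), b ≠ 0 ∧ ∑ i ∈ s, g i = a / b ∧
      intSize a ≤ 1 + ∑ i ∈ s, ratSize (g i) ∧ Nat.size b ≤ 1 + ∑ i ∈ s, ratSize (g i) := by
  classical
  induction s using Finset.induction_on with
  | empty => exact ⟨0, 1, by simp, by simp, by simp [intSize], by simp⟩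
  | insert i s hi ih =>
    obtain ⟨a, b, hb, hsum, ha, hb'⟩ := ih
    refine ⟨(g i).num * b + a * (g i).den, (g i).den * b, Nat.mul_ne_zero (g i).den_nz hb, ?_, ?_,
      ?_⟩
    · rw [Finset.sum_insert hi, hsum]
      have h₁ : ((g i).den : ℚ) ≠ 0 := by exact_mod_cast (g i).den_nz
      have h₂ : (b : ℚ) ≠ 0 := by exact_mod_cast hb
      conv_lhs => rw [← Rat.num_div_den (g i)]
      push_cast
      field_simp
    -- Here the bound by the maximum is essential: the subadditive bound would count the sum of the
    -- previous sizes twice.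
    · have h₁ := intSize_add_le_max ((g i).num * b) (a * (g i).den)
      have h₂ := intSize_mul_natCast_le (g i).num b
      have h₃ := intSize_mul_natCast_le a (g i).den
      have h₄ := one_le_intSize (g i).num
      have h₅ := one_le_size_den (g i)
      rw [Finset.sum_insert hi]
      have h₆ : ratSize (g i) = intSize (g i).num + Nat.size (g i).den := rfl
      omega
    · have h₁ := natSize_mul_le (g i).den b
      have h₆ : ratSize (g i) = intSize (g i).num + Nat.size (g i).den := rfl
      rw [Finset.sum_insert hi]
      omega

/-- Iterating `ratSize_add_le` would lose a factor `2` per summand, hence an exponential in `n`.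
Instead all summands are brought over one common denominator; numerator and denominator each have
length at most one plus the total length. -/
theorem ratSize_sumObj_le {n : ℕ} (f : Fin n → ℚ) (x : Sol n) :
    ratSize (sumObj f x) ≤ 2 + 2 * ∑ i, ratSize (f i) := by
  have hx : sumObj f x = ∑ i with x i = true, f i := by
    rw [Finset.sum_filter]
    refine Finset.sum_congr rfl fun i _ => ?_
    by_cases h : x i <;> simp [bit, h]
  obtain ⟨a, b, hb, h, ha, hb'⟩ := exists_sum_eq_div (Finset.univ.filter fun i => x i = true) f
  have h₁ := ratSize_le_of_eq_div hb (hx.trans h)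
  have h₂ : ∑ i with x i = true, ratSize (f i) ≤ ∑ i, ratSize (f i) :=
    Finset.sum_le_sum_of_subset (Finset.filter_subset _ _)
  omega

/-! ### The table of best solutions, one per key

Register use: `2` holds the number of keys, `3` the current element, `4` the current key, `5` the
key of the current element, `6`, `7` and `10` are loop counters, `8` is a flag, `9` counts the
solutions found, and the registers from `20` on hold the entries of the current element. The row of
the key `q` consists of a flag in integer array `3`, a solution in integer array `4`, its components
in the integer arrays from `11` on, and its objective value in the `F`-array `1`. -/

/-- Copies the block of `n` cells of the array `src` starting at `es` to the array `dst`,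
starting at `ed`. -/
def copyBlock (dst src : ℕ) (ed es : IExp) : Prog :=
  forUp 6 (.var 0) (.setIArr dst (.add ed (.var 6)) (.arr src (.add es (.var 6))))

/-- `(n + 1) ^ d`. -/
def powE : ℕ → IExp
  | 0 => .const 1
  | d + 1 => .mul (powE d) (.add (.var 0) (.const 1))

/-- The key with the digits in the registers `20, …, 20 + d - 1`. -/
def keyE : ℕ → IExp
  | 0 => .const 0
  | d + 1 => .add (keyE d) (.mul (.var (20 + d)) (powE d))

/-- Stored category numbers start at one, hence the `+ 1`. The last case is the cardinality
component, to which every element contributes. -/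
def entryTest (Kt Kh j : ℕ) : BExp :=
  if j < Kt then .leI (.const ((j : ℤ) + 1)) (.arr 0 (.var 3))
  else if j < Kt + Kh then .leI (.const ((j - Kt : ℕ) + 1)) (.arr 1 (.var 3))
  else .leI (.const 0) (.const 0)

def loadEntries (Kt Kh : ℕ) : Prog :=
  seqRange (fun j => .ite (entryTest Kt Kh j) (.setIVar (20 + j) (.const 1))
    (.setIVar (20 + j) (.const 0))) (Kt + Kh + 1)

/-- The key of the row to which the current element is added. -/
def srcE : IExp := .sub (.var 4) (.var 5)

def updateRow (Kt Kh : ℕ) : Prog :=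
  .seq (copyBlock 4 4 (.mul (.var 4) (.var 0)) (.mul srcE (.var 0)))
  (.seq (.setIArr 4 (.add (.mul (.var 4) (.var 0)) (.var 3)) (.const 1))
  (.seq (seqRange (fun j => .setIArr (11 + j) (.var 4)
    (.add (.arr (11 + j) srcE) (.var (20 + j)))) (Kt + Kh + 1))
  (.seq (.setRArr 1 (.var 4) (.add (.arr 1 srcE) (.arr 0 (.var 3))))
  (.setIArr 3 (.var 4) (.const 1)))))

/-- The source row must be nonempty, and the target row must be empty or no better than the
candidate. Comparing values after multiplication by `γ` covers minimization, maximization and the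
absent objective at once. -/
def improveTest (γ : ℤ) : BExp :=
  .and (.leI (.const 1) (.arr 3 srcE)) (.not (.and (.leI (.const 1) (.arr 3 (.var 4)))
    (.not (.leR (.mul (.ofInt (.const γ)) (.add (.arr 1 srcE) (.arr 0 (.var 3))))
      (.mul (.ofInt (.const γ)) (.arr 1 (.var 4)))))))

/-- Register `4` runs through the keys downwards while the counter `10` runs upwards. The source row
has a smaller key than the target, so it has not yet been modified and no element is used twice. -/
def addElement (Kt Kh : ℕ) (γ : ℤ) : Prog :=
  .seq (loadEntries Kt Kh) (.seq (.setIVar 5 (keyE (Kt + Kh + 1)))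
    (forUp 10 (.var 2) (.seq (.setIVar 4 (.sub (.sub (.var 2) (.const 1)) (.var 10)))
      (.ite (improveTest γ) (updateRow Kt Kh) .skip))))

def buildTable (Kt Kh : ℕ) (γ : ℤ) : Prog :=
  .seq (.setIVar 2 (powE (Kt + Kh + 1))) (.seq (.setIArr 3 (.const 0) (.const 1))
    (forUp 3 (.var 0) (addElement Kt Kh γ)))

section Table

variable {F : Type} [Ring F] [LinearOrder F] {Kt Kh n : ℕ} {rs : F → ℕ} {C V : ℕ}

theorem powE_val {F : Type} (s : Mem F) (d : ℕ) : (powE d).val s = (s.ivar 0 + 1) ^ d := by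
  induction d with
  | zero => simp [powE, IExp.val]
  | succ d ih => simp [powE, IExp.val, ih, pow_succ]

theorem keyE_val {F : Type} (s : Mem F) (d : ℕ) :
    (keyE d).val s = ∑ j ∈ Finset.range d, s.ivar (20 + j) * (s.ivar 0 + 1) ^ j := by
  induction d with
  | zero => rfl
  | succ d ih => simp [keyE, IExp.val, ih, powE_val, Finset.sum_range_succ]

/-- The number of keys. -/
def numKeys (Kt Kh n : ℕ) : ℕ := (n + 1) ^ (Kt + Kh + 1)

theorem numKeys_cast : (numKeys Kt Kh n : ℤ) = ((n : ℤ) + 1) ^ (Kt + Kh + 1) := by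
  simp [numKeys]

/-- All quantities that occur in the computation have size at most `V`. -/
structure Fits (rs : F → ℕ) (V : ℕ) (γ : ℤ) (I : Inst F Kt Kh n) : Prop where
  keys_le : numKeys Kt Kh n + Kt + Kh ≤ V
  sum_le : ∀ x, rs (sumObj I.f x) ≤ V
  mul_sum_le : ∀ x, rs ((γ : F) * sumObj I.f x) ≤ V

theorem Fits.lt {γ : ℤ} {I : Inst F Kt Kh n} (h : Fits rs V γ I) : n < V := by
  have h₁ := h.keys_le
  have h₂ : (n + 1) ^ 1 ≤ (n + 1) ^ (Kt + Kh + 1) := Nat.pow_le_pow_right (by omega) (by omega)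
  rw [pow_one] at h₂
  unfold numKeys at h₁
  omega

/-- The parts of the memory that do not change while the table is built. -/
structure Env (rs : F → ℕ) (V : ℕ) (I : Inst F Kt Kh n) (w : ℕ) (s : Mem F) : Prop where
  bounded : s.Bounded rs V
  n_eq : s.ivar 0 = n
  w_eq : s.ivar 1 = w
  keys_eq : s.ivar 2 = numKeys Kt Kh n
  count_eq : s.ivar 9 = 0
  catT_eq : ∀ i : Fin n, s.iarr 0 i = (I.catT i : ℕ) + 1
  catH_eq : ∀ i : Fin n, s.iarr 1 i = (I.catH i : ℕ) + 1
  f_eq : ∀ i : Fin n, s.rarr 0 i = I.f i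

variable {I : Inst F Kt Kh n} {w : ℕ} {s : Mem F}

theorem Env.setI (h : Env rs V I w s) {r : ℕ} {v : ℤ} (hv : |v| ≤ V)
    (hr : r ≠ 0 ∧ r ≠ 1 ∧ r ≠ 2 ∧ r ≠ 9) : Env rs V I w (s.setI r v) where
  bounded := h.bounded.setI r hv
  n_eq := by simp [hr.1.symm, h.n_eq]
  w_eq := by simp [hr.2.1.symm, h.w_eq]
  keys_eq := by simp [hr.2.2.1.symm, h.keys_eq]
  count_eq := by simp [hr.2.2.2.symm, h.count_eq]
  catT_eq := h.catT_eq
  catH_eq := h.catH_eq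
  f_eq := h.f_eq

theorem Env.of_eq {s' : Mem F} (h : Env rs V I w s) (hb : s'.Bounded rs V)
    (h0 : ∀ r, r ≠ 6 → s'.ivar r = s.ivar r) (h1 : ∀ a, a < 3 → s'.iarr a = s.iarr a)
    (h2 : s'.rarr 0 = s.rarr 0) : Env rs V I w s' where
  bounded := hb
  n_eq := by rw [h0 _ (by decide), h.n_eq]
  w_eq := by rw [h0 _ (by decide), h.w_eq]
  keys_eq := by rw [h0 _ (by decide), h.keys_eq]
  count_eq := by rw [h0 _ (by decide), h.count_eq]
  catT_eq := by rw [h1 _ (by decide)]; exact h.catT_eq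
  catH_eq := by rw [h1 _ (by decide)]; exact h.catH_eq
  f_eq := by rw [h2]; exact h.f_eq

/-! #### Copying a block -/

theorem runs_copyBlock {dst src : ℕ} {ed es : IExp} {d e : ℤ} {Q : Mem F → Prop}
    (hC : SizeBound rs C) (hs : s.Bounded rs V) (hn : s.ivar 0 = n) (hnV : n ≤ V)
    (hd : ∀ s' : Mem F, (∀ r, r ≠ 6 → s'.ivar r = s.ivar r) → ed.val s' = d)
    (he : ∀ s' : Mem F, (∀ r, r ≠ 6 → s'.ivar r = s.ivar r) → es.val s' = e)
    (hsep : src ≠ dst ∨ e + n ≤ d)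
    (hQ : ∀ s' : Mem F, s'.Bounded rs V → (∀ r, r ≠ 6 → s'.ivar r = s.ivar r) →
      s'.rarr = s.rarr → (∀ a, a ≠ dst → s'.iarr a = s.iarr a) →
      (∀ i : Fin n, s'.iarr dst (d + i) = s.iarr src (e + i)) →
      (∀ a, a < d ∨ d + n ≤ a → s'.iarr dst a = s.iarr dst a) → Q s') :
    Runs rs C V (copyBlock dst src ed es) (1 + (n * (1 + 2) + 1)) s Q := by
  refine Runs.forUp n (fun k s' => s'.Bounded rs V ∧ s'.ivar 6 = k ∧
      (∀ r, r ≠ 6 → s'.ivar r = s.ivar r) ∧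
      s'.rarr = s.rarr ∧ (∀ a, a ≠ dst → s'.iarr a = s.iarr a) ∧
      (∀ i : ℕ, i < k → s'.iarr dst (d + i) = s.iarr src (e + i)) ∧
      (∀ a, a < d ∨ d + k ≤ a → s'.iarr dst a = s.iarr dst a)) hC hs ?_ ?_ ?_ ?_
  · refine ⟨hs.setI _ (by simp), by simp, ?_, rfl, fun _ _ => rfl, by simp, fun _ _ => rfl⟩
    intro r hr
    simp [hr]
  · rintro k s' hk ⟨h₁, h₂, h₃, -⟩
    exact ⟨h₁, h₂, by simp [IExp.val, h₃ 0 (by decide), hn]⟩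
  · rintro k s' hk ⟨h₁, h₂, h₃, h₄, h₅, h₆, h₇⟩
    -- When source and destination are the same array, the source block ends before the destination
    -- block, so the cell being read is still unchanged.
    have hsrc : s'.iarr src (e + k) = s.iarr src (e + k) := by
      by_cases hne : src = dst
      · subst hne
        rcases hsep with hsep | hsep
        · exact absurd rfl hsep
        · exact h₇ _ (Or.inl (by omega))
      · rw [h₅ _ hne]
    refine Runs.setIArr h₁ ?_
    have hb : (s'.setIA dst (d + k) (s.iarr src (e + k))).Bounded rs V :=
      h₁.setIA _ _ (hs.iarr_le _ _)
    simp only [IExp.val, hd s' h₃, he s' h₃, h₂, hsrc]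
    refine ⟨hb, by simp [h₂], hb.setI _ ?_, by simp, ?_, by simp [h₄], ?_, ?_, ?_⟩
    · rw [abs_of_nonneg (by positivity)]
      omega
    · intro r hr
      simp [hr, h₃ r hr]
    · intro a ha
      rw [Mem.setI_iarr, Mem.setIA_iarr_ne _ _ _ _ _ ha, h₅ a ha]
    · intro i hi
      rw [Mem.setI_iarr, Mem.setIA_iarr]
      by_cases hik : i = k
      · subst hik; simp
      · rw [if_neg (by omega), h₆ i (by omega)]
    · intro a ha
      rw [Mem.setI_iarr, Mem.setIA_iarr, if_neg (by push_cast at ha; omega)]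
      exact h₇ a (by push_cast at ha; omega)
  · rintro s' ⟨h₁, -, h₃, h₄, h₅, h₆, h₇⟩
    exact hQ s' h₁ h₃ h₄ h₅ (fun i => h₆ i i.2) h₇

/-! #### Rows -/

/-- Row `q` of the table contains the solution `x`. -/
structure IsRow (I : Inst F Kt Kh n) (s : Mem F) (q : ℤ) (x : Sol n) : Prop where
  flag : s.iarr 3 q = 1
  bits : ∀ i : Fin n, s.iarr 4 (q * n + i) = bit x i
  comps : ∀ j < Kt + Kh + 1, s.iarr (11 + j) q = I.comp x j
  value : s.rarr 1 q = sumObj I.f x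

/-- `x` selects only elements with index less than `k`. -/
def SuppBelow (k : ℕ) (x : Sol n) : Prop := ∀ i : Fin n, k ≤ i → x i = false

/-- Row `q` contains a best solution among those with key `q` that select only elements with index
less than `k`, if there is any. -/
def RowOK (γ : ℤ) (I : Inst F Kt Kh n) (k : ℕ) (s : Mem F) (q : ℤ) : Prop :=
  (s.iarr 3 q = 0 ∧ ∀ y, SuppBelow k y → I.key y ≠ q) ∨
    ∃ x, IsRow I s q x ∧ SuppBelow k x ∧ I.key x = q ∧
      ∀ y, SuppBelow k y → I.key y = q → (γ : F) * sumObj I.f x ≤ γ * sumObj I.f y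

structure SameRow (Kt Kh n : ℕ) (s s' : Mem F) (q : ℤ) : Prop where
  flag : s'.iarr 3 q = s.iarr 3 q
  bits : ∀ i : Fin n, s'.iarr 4 (q * n + i) = s.iarr 4 (q * n + i)
  comps : ∀ j < Kt + Kh + 1, s'.iarr (11 + j) q = s.iarr (11 + j) q
  value : s'.rarr 1 q = s.rarr 1 q

theorem IsRow.congr {s' : Mem F} {q : ℤ} {x : Sol n} (h : IsRow I s q x)
    (hs : SameRow Kt Kh n s s' q) : IsRow I s' q x where
  flag := hs.flag.trans h.flag
  bits i := (hs.bits i).trans (h.bits i)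
  comps j hj := (hs.comps j hj).trans (h.comps j hj)
  value := hs.value.trans h.value

theorem RowOK.congr {s' : Mem F} {q : ℤ} {γ : ℤ} {k : ℕ} (h : RowOK γ I k s q)
    (hs : SameRow Kt Kh n s s' q) : RowOK γ I k s' q := by
  rcases h with ⟨h₁, h₂⟩ | ⟨x, h₁, h₂⟩
  · exact Or.inl ⟨hs.flag.trans h₁, h₂⟩
  · exact Or.inr ⟨x, h₁.congr hs, h₂⟩

/-- Rows are considered for all integers, because `q - I.elemKey k` can be negative and its flag is
still read. Rows outside the range of keys are empty at every stage. -/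
theorem RowOK.of_not_key {q : ℤ} {γ : ℤ} {k : ℕ} (k' : ℕ) (h : RowOK γ I k s q)
    (hq : ∀ y, I.key y ≠ q) : RowOK γ I k' s q := by
  rcases h with ⟨h₁, h₂⟩ | ⟨x, -, -, h₂, -⟩
  · exact Or.inl ⟨h₁, fun y _ => hq y⟩
  · exact absurd h₂ (hq x)

theorem RowOK.flag_mem {q : ℤ} {γ : ℤ} {k : ℕ} (h : RowOK γ I k s q) :
    s.iarr 3 q = 0 ∨ s.iarr 3 q = 1 := by
  rcases h with ⟨h, -⟩ | ⟨x, h, -⟩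
  exacts [Or.inl h, Or.inr h.flag]

theorem SuppBelow.mono {k k' : ℕ} {x : Sol n} (h : SuppBelow k x) (hk : k ≤ k') :
    SuppBelow k' x := fun i hi => h i (hk.trans hi)

theorem SuppBelow.update {k : Fin n} {x : Sol n} (h : SuppBelow k x) :
    SuppBelow (k + 1) (Function.update x k true) := fun i hi => by
  have : i ≠ k := by rintro rfl; omega
  rw [Function.update_of_ne this]
  exact h i (by omega)

/-- The case distinction behind the recursion: element `k` is either not selected or can be removed.
-/
theorem SuppBelow.succ_cases {k : Fin n} {y : Sol n} (h : SuppBelow (k + 1) y) :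
    SuppBelow k y ∨ ∃ y', SuppBelow k y' ∧ y = Function.update y' k true := by
  have hlt : ∀ i : Fin n, (k : ℕ) ≤ i → i ≠ k → (k : ℕ) + 1 ≤ i := fun i hi hne => by
    have : (i : ℕ) ≠ k := fun h => hne (Fin.ext h)
    omega
  cases hy : y k
  · left
    intro i hi
    by_cases hik : i = k
    · rw [hik, hy]
    · exact h i (hlt i hi hik)
  · right
    refine ⟨Function.update y k false, fun i hi => ?_, ?_⟩
    · by_cases hik : i = k
      · simp [hik]
      · rw [Function.update_of_ne hik]
        exact h i (hlt i hi hik)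
    · rw [Function.update_idem, ← hy, Function.update_eq_self]

theorem block_disjoint {q q' i : ℤ} (hq : q' ≠ q) (h₀ : 0 ≤ i) (h₁ : i < n) :
    q' * n + i < q * n ∨ q * n + n ≤ q' * n + i := by
  rcases lt_or_gt_of_ne hq with h | h
  · left
    have : (q' + 1) * n ≤ q * n := mul_le_mul_of_nonneg_right (by omega) (by positivity)
    linarith
  · right
    have : (q + 1) * n ≤ q' * n := mul_le_mul_of_nonneg_right (by omega) (by positivity)
    linarith

theorem runs_updateRow {γ : ℤ} {k : Fin n} {q : ℤ} {x : Sol n} (hC : SizeBound rs C)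
    (hV : Fits rs V γ I) (hs : Env rs V I w s) (hk : s.ivar 3 = k) (hq : s.ivar 4 = q)
    (hv : s.ivar 5 = I.elemKey k) (hent : ∀ j < Kt + Kh + 1, s.ivar (20 + j) = I.entry k j)
    (hx : IsRow I s (q - I.elemKey k) x) (hxk : x k = false) :
    Runs rs C V (updateRow Kt Kh)
      ((1 + (n * (1 + 2) + 1)) + (1 + ((1 + (Kt + Kh + 1) * 1) + (1 + 1)))) s fun s' =>
        Env rs V I w s' ∧ (∀ r, r ≠ 6 → s'.ivar r = s.ivar r) ∧
        IsRow I s' q (Function.update x k true) ∧ ∀ q', q' ≠ q → SameRow Kt Kh n s s' q' := by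
  have hnV := hV.lt
  have hv1 := I.one_le_elemKey k
  refine .seq (runs_copyBlock (d := q * n) (e := (q - I.elemKey k) * n) hC hs.bounded hs.n_eq
    hnV.le ?_ ?_ (Or.inr ?_) ?_)
  · intro s' h
    simp [IExp.val, h, hq, hs.n_eq]
  · intro s' h
    simp [IExp.val, srcE, h, hq, hv, hs.n_eq]
  -- Since the key of the element is at least `1`, the source block lies entirely before the target
  -- block.
  · nlinarith
  intro s₁ hb₁ hi₁ hr₁ ha₁ hc₁ ho₁
  refine .seq (.setIArr hb₁ ?_)
  simp only [IExp.val, hi₁ 4 (by decide), hi₁ 0 (by decide), hi₁ 3 (by decide), hq, hs.n_eq, hk]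
  have hb₂ : (s₁.setIA 4 (q * n + k) 1).Bounded rs V := hb₁.setIA _ _ (by simp; omega)
  have hbits : ∀ i : Fin n, (s₁.setIA 4 (q * n + k) 1).iarr 4 (q * n + i) =
      bit (Function.update x k true) i := by
    intro i
    rw [Mem.setIA_iarr, bit_update_true]
    by_cases hik : i = k
    · subst hik; simp
    · rw [if_neg, if_neg hik, hc₁ i, hx.bits i]
      rintro ⟨-, h⟩
      exact hik (Fin.ext (by omega))
  have hbits' : ∀ q', q' ≠ q → ∀ i : Fin n,
      (s₁.setIA 4 (q * n + k) 1).iarr 4 (q' * n + i) = s.iarr 4 (q' * n + i) := by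
    intro q' hne i
    have hdis := block_disjoint (n := n) (i := i) hne (by positivity) (by exact_mod_cast i.2)
    rw [Mem.setIA_iarr, if_neg (by have := k.2; omega), ho₁ _ hdis]
  have ha₂ : ∀ a, a ≠ 4 → (s₁.setIA 4 (q * n + k) 1).iarr a = s.iarr a := by
    intro a ha
    rw [Mem.setIA_iarr_ne _ _ _ _ _ ha, ha₁ a ha]
  have hi₂ : ∀ r, r ≠ 6 → (s₁.setIA 4 (q * n + k) 1).ivar r = s.ivar r := hi₁
  have hr₂ : (s₁.setIA 4 (q * n + k) 1).rarr = s.rarr := hr₁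
  generalize s₁.setIA 4 (q * n + k) 1 = s₂ at hb₂ hbits hbits' ha₂ hi₂ hr₂ ⊢
  clear hb₁ hi₁ hr₁ ha₁ hc₁ ho₁
  refine .seq (.seqRange (Kt + Kh + 1) (fun m s' => s'.Bounded rs V ∧
    (∀ r, r ≠ 6 → s'.ivar r = s.ivar r) ∧ s'.rarr = s.rarr ∧ s'.iarr 4 = s₂.iarr 4 ∧
    (∀ a, a ≠ 4 → a < 11 → s'.iarr a = s.iarr a) ∧
    (∀ j, m ≤ j → s'.iarr (11 + j) = s.iarr (11 + j)) ∧
    (∀ j < m, ∀ q', s'.iarr (11 + j) q' =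
      if q' = q then I.comp (Function.update x k true) j else s.iarr (11 + j) q'))
    ⟨hb₂, hi₂, hr₂, rfl, fun a ha _ => ha₂ a ha, fun j _ => ha₂ _ (by omega), by simp⟩ ?_ ?_)
  · rintro j s' hj ⟨h₁, h₂, h₃, h₄, h₅, h₆, h₇⟩
    refine .setIArr h₁ ?_
    have hval : s.iarr (11 + j) (q - I.elemKey k) + s.ivar (20 + j) =
        I.comp (Function.update x k true) j := by
      rw [hx.comps j hj, hent j hj, I.comp_update hxk]
    simp only [IExp.val, srcE, h₂ 4 (by decide), h₂ 5 (by decide), h₂ (20 + j) (by omega), hq, hv,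
      h₆ j le_rfl, hval]
    refine ⟨h₁.setIA _ _ ?_, h₂, h₃, ?_, ?_, ?_, ?_⟩
    · have := I.comp_nonneg (Function.update x k true) j
      have := I.comp_le (Function.update x k true) j
      rw [abs_of_nonneg (by assumption)]
      omega
    · rw [Mem.setIA_iarr_ne _ _ _ _ _ (by omega), h₄]
    · intro a ha ha'
      rw [Mem.setIA_iarr_ne _ _ _ _ _ (by omega), h₅ a ha ha']
    · intro j' hj'
      rw [Mem.setIA_iarr_ne _ _ _ _ _ (by omega), h₆ j' (by omega)]
    · intro j' hj' q'
      rw [Mem.setIA_iarr]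
      by_cases hjj : j' = j
      · subst hjj
        simp [h₆ j' le_rfl]
      · rw [if_neg (by omega), h₇ j' (by omega)]
  rintro s₃ ⟨h₁, h₂, h₃, h₄, h₅, h₆, h₇⟩
  have hsum : s.rarr 1 (q - I.elemKey k) + s.rarr 0 k = sumObj I.f (Function.update x k true) := by
    rw [hx.value, hs.f_eq, sumObj_update _ hxk]
  refine .seq (.setRArr hC h₁ (.setIArr (h₁.setRA _ _ ?_) ?_))
  · simp only [IExp.val, RExp.val, srcE, h₂ 4 (by decide), h₂ 5 (by decide), h₂ 3 (by decide), h₃,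
      hq, hv, hk, hsum]
    exact hV.sum_le _
  · simp only [IExp.val, RExp.val, srcE, h₂ 4 (by decide), h₂ 5 (by decide), h₂ 3 (by decide), h₃,
      hq, hv, hk, hsum, Mem.setRA_ivar]
    refine ⟨hs.of_eq ((h₁.setRA _ _ (hV.sum_le _)).setIA _ _ (by simp; omega)) h₂ ?_ ?_, h₂, ?_, ?_⟩
    · intro a ha
      rw [Mem.setIA_iarr_ne _ _ _ _ _ (by omega), Mem.setRA_iarr, h₅ a (by omega) (by omega)]
    · rw [Mem.setIA_rarr, Mem.setRA_rarr_ne _ _ _ _ _ (by decide), h₃]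
    · constructor
      · simp [Mem.setIA_iarr]
      · intro i
        rw [Mem.setIA_iarr_ne _ _ _ _ _ (by decide), Mem.setRA_iarr, h₄, hbits]
      · intro j hj
        rw [Mem.setIA_iarr_ne _ _ _ _ _ (by omega), Mem.setRA_iarr, h₇ j hj, if_pos rfl]
      · simp [Mem.setRA_rarr]
    · intro q' hne
      constructor
      · rw [Mem.setIA_iarr, if_neg (by tauto), Mem.setRA_iarr, h₅ 3 (by decide) (by decide)]
      · intro i
        rw [Mem.setIA_iarr_ne _ _ _ _ _ (by decide), Mem.setRA_iarr, h₄, hbits' q' hne]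
      · intro j hj
        rw [Mem.setIA_iarr_ne _ _ _ _ _ (by omega), Mem.setRA_iarr, h₇ j hj, if_neg hne]
      · rw [Mem.setIA_rarr, Mem.setRA_rarr, if_neg (by tauto), h₃]

end Table

/-! ### Correctness of the dynamic programming recursion -/

section Build

variable {F : Type} [Ring F] [LinearOrder F] {Kt Kh n : ℕ} {rs : F → ℕ} {C V : ℕ}
  {I : Inst F Kt Kh n} {w : ℕ} {s : Mem F} {γ : ℤ}

theorem RowOK.keep {k : Fin n} {q : ℤ} (h : RowOK γ I k s q)
    (hno : ∀ y, SuppBelow k y → I.key y = q - I.elemKey k →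
      s.iarr 3 q = 1 ∧ (γ : F) * s.rarr 1 q ≤ γ * (sumObj I.f y + I.f k)) :
    RowOK γ I (k + 1) s q := by
  rcases h with ⟨h₁, h₂⟩ | ⟨x, h₁, h₂, h₃, h₄⟩
  · refine Or.inl ⟨h₁, fun y hy hkey => ?_⟩
    rcases hy.succ_cases with hy | ⟨y', hy', rfl⟩
    · exact h₂ y hy hkey
    · rw [I.key_update (hy' k le_rfl)] at hkey
      have := (hno y' hy' (by omega)).1
      omega
  · refine Or.inr ⟨x, h₁, h₂.mono (by omega), h₃, fun y hy hkey => ?_⟩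
    rcases hy.succ_cases with hy | ⟨y', hy', rfl⟩
    · exact h₄ y hy hkey
    · rw [I.key_update (hy' k le_rfl)] at hkey
      have := (hno y' hy' (by omega)).2
      rwa [sumObj_update _ (hy' k le_rfl), ← h₁.value]

/-- A competitor without element `k` is no better than the old row, which the candidate matches or
improves. A competitor with `k` is compared after removing `k` from both, as adding `γ f_k` to both
sides preserves the order. -/
theorem RowOK.take [IsOrderedAddMonoid F] {k : Fin n} {q : ℤ} {x : Sol n} {s' : Mem F}
    (h : RowOK γ I k s q) (hx : SuppBelow k x) (hkey : I.key x = q - I.elemKey k)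
    (hopt : ∀ y, SuppBelow k y → I.key y = q - I.elemKey k →
      (γ : F) * sumObj I.f x ≤ γ * sumObj I.f y)
    (himp : s.iarr 3 q = 1 → (γ : F) * (sumObj I.f x + I.f k) ≤ γ * s.rarr 1 q)
    (hs' : IsRow I s' q (Function.update x k true)) : RowOK γ I (k + 1) s' q := by
  refine Or.inr ⟨_, hs', hx.update, by rw [I.key_update (hx k le_rfl)]; omega, fun y hy hyk => ?_⟩
  rw [sumObj_update _ (hx k le_rfl)]
  rcases hy.succ_cases with hy | ⟨y', hy', rfl⟩
  · rcases h with ⟨-, h₂⟩ | ⟨x', h₁, -, -, h₄⟩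
    · exact absurd hyk (h₂ y hy)
    · refine (himp h₁.flag).trans ?_
      rw [h₁.value]
      exact h₄ y hy hyk
  · rw [I.key_update (hy' k le_rfl)] at hyk
    rw [sumObj_update _ (hy' k le_rfl), mul_add, mul_add]
    exact add_le_add_left (hopt y' hy' (by omega)) _

theorem entryTest_holds {k : Fin n} {j : ℕ} (hs : Env rs V I w s) (hk : s.ivar 3 = k) :
    (entryTest Kt Kh j).Holds s ↔ I.entry k j = 1 := by
  unfold entryTest Inst.entry
  split_ifs with h₁ h₂ h₃ h₄ <;>
    simp only [BExp.Holds, IExp.val, hk, hs.catT_eq, hs.catH_eq] <;> simp <;> omega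

theorem runs_loadEntries {k : Fin n} (hC : SizeBound rs C) (hV : Fits rs V γ I)
    (hs : Env rs V I w s) (hk : s.ivar 3 = k) :
    Runs rs C V (loadEntries Kt Kh) (1 + (Kt + Kh + 1) * (1 + 1)) s fun s' =>
      Env rs V I w s' ∧ s'.ivar 3 = k ∧ (∀ j < Kt + Kh + 1, s'.ivar (20 + j) = I.entry k j) ∧
      s'.iarr = s.iarr ∧ s'.rarr = s.rarr := by
  have hnV := hV.lt
  refine .seqRange (Kt + Kh + 1) (fun m s' => Env rs V I w s' ∧ s'.ivar 3 = k ∧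
    (∀ j < m, s'.ivar (20 + j) = I.entry k j) ∧ s'.iarr = s.iarr ∧ s'.rarr = s.rarr)
    ⟨hs, hk, by simp, rfl, rfl⟩ ?_ fun _ h => h
  rintro m s' hm ⟨h₁, h₂, h₃, h₄, h₅⟩
  have key : ∀ c : ℤ, I.entry k m = c → (c = 0 ∨ c = 1) →
      Runs rs C V (.setIVar (20 + m) (.const c)) 1 s' fun s' => Env rs V I w s' ∧ s'.ivar 3 = k ∧
        (∀ j < m + 1, s'.ivar (20 + j) = I.entry k j) ∧ s'.iarr = s.iarr ∧ s'.rarr = s.rarr := by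
    intro c hc hc'
    refine .setIVar h₁.bounded ⟨h₁.setI ?_ (by omega), ?_, fun j hj => ?_, h₄, h₅⟩
    · rcases hc' with rfl | rfl <;> simp [IExp.val]
      omega
    · rw [Mem.setI_ivar, if_neg (by omega), h₂]
    · rw [Mem.setI_ivar]
      by_cases hjm : j = m
      · subst hjm
        simp [IExp.val, hc]
      · rw [if_neg (by omega), h₃ j (by omega)]
  refine .ite hC h₁.bounded (fun h => ?_) (fun h => ?_)
  · rw [entryTest_holds h₁ h₂] at h
    exact key 1 h (by simp)
  · rw [entryTest_holds h₁ h₂] at h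
    exact key 0 ((I.entry_mem k m).resolve_right h) (by simp)

def updateTime (Kt Kh n : ℕ) : ℕ :=
  (1 + (n * (1 + 2) + 1)) + (1 + ((1 + (Kt + Kh + 1) * 1) + (1 + 1)))

theorem runs_improve [IsOrderedAddMonoid F] {k : Fin n} {q : ℤ} (hC : SizeBound rs C)
    (hV : Fits rs V γ I) (hs : Env rs V I w s) (hk : s.ivar 3 = k) (hq : s.ivar 4 = q)
    (hv : s.ivar 5 = I.elemKey k) (hent : ∀ j < Kt + Kh + 1, s.ivar (20 + j) = I.entry k j)
    (h₁ : RowOK γ I k s (q - I.elemKey k)) (h₂ : RowOK γ I k s q) :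
    Runs rs C V (.ite (improveTest γ) (updateRow Kt Kh) .skip) (updateTime Kt Kh n + 1) s
      fun s' => Env rs V I w s' ∧ (∀ r, r ≠ 6 → s'.ivar r = s.ivar r) ∧
        RowOK γ I (k + 1) s' q ∧ ∀ q', q' ≠ q → SameRow Kt Kh n s s' q' := by
  have htest : (improveTest γ).Holds s ↔ 1 ≤ s.iarr 3 (q - I.elemKey k) ∧
      (1 ≤ s.iarr 3 q → (γ : F) * (s.rarr 1 (q - I.elemKey k) + I.f k) ≤ γ * s.rarr 1 q) := by
    simp only [improveTest, BExp.Holds, RExp.val, IExp.val, srcE, hk, hq, hv, hs.f_eq]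
    tauto
  refine .ite hC hs.bounded (fun h => ?_) (fun h => ?_)
  · rw [htest] at h
    rcases h₁ with ⟨h₀, -⟩ | ⟨x, hx, hsupp, hkey, hopt⟩
    · omega
    · refine (runs_updateRow hC hV hs hk hq hv hent hx (hsupp k le_rfl)).imp le_rfl ?_
      rintro s' ⟨ha, hb, hc, hd⟩
      refine ⟨ha, hb, h₂.take hsupp hkey hopt (fun hf => ?_) hc, hd⟩
      rw [← hx.value]
      exact h.2 hf.ge
  · rw [htest] at h
    refine (Runs.skip ?_).imp (by unfold updateTime; omega) fun _ h => h
    refine ⟨hs, fun _ _ => rfl, h₂.keep fun y hy hkey => ?_,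
      fun q' _ => ⟨rfl, fun _ => rfl, fun _ _ => rfl, rfl⟩⟩
    rcases h₁ with ⟨-, h₀⟩ | ⟨x, hx, hsupp, -, hopt⟩
    · exact absurd hkey (h₀ y hy)
    · simp only [hx.flag, le_refl, true_and, not_forall, not_le] at h
      obtain ⟨hf, hlt⟩ := h
      refine ⟨by have := h₂.flag_mem; omega, hlt.le.trans ?_⟩
      rw [hx.value, mul_add, mul_add]
      exact add_le_add_left (hopt y hy hkey) _

def addElementTime (Kt Kh n : ℕ) : ℕ :=
  (1 + (Kt + Kh + 1) * (1 + 1)) +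
    (1 + (1 + (numKeys Kt Kh n * ((1 + (updateTime Kt Kh n + 1)) + 2) + 1)))

theorem runs_addElement [IsOrderedAddMonoid F] {k : Fin n} (hC : SizeBound rs C)
    (hV : Fits rs V γ I) (hs : Env rs V I w s) (hk : s.ivar 3 = k) (hrow : ∀ q, RowOK γ I k s q) :
    Runs rs C V (addElement Kt Kh γ) (addElementTime Kt Kh n) s fun s' =>
      Env rs V I w s' ∧ s'.ivar 3 = k ∧ ∀ q, RowOK γ I (k + 1) s' q := by
  have hMV : numKeys Kt Kh n ≤ V := by have := hV.keys_le; omega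
  refine .seq ((runs_loadEntries hC hV hs hk).imp le_rfl ?_)
  rintro s₁ ⟨hs₁, hk₁, hent₁, hia₁, hra₁⟩
  have hrow₁ : ∀ q, RowOK γ I k s₁ q := fun q => (hrow q).congr
    ⟨by rw [hia₁], fun _ => by rw [hia₁], fun _ _ => by rw [hia₁], by rw [hra₁]⟩
  have hkeyE : (keyE (Kt + Kh + 1)).val s₁ = I.elemKey k := by
    rw [keyE_val, hs₁.n_eq, Inst.elemKey]
    exact Finset.sum_congr rfl fun j hj => by rw [hent₁ j (Finset.mem_range.1 hj)]
  have hv : |I.elemKey k| ≤ V := by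
    have h₁ := I.one_le_elemKey k
    have h₂ := I.elemKey_lt k
    have h₃ : (numKeys Kt Kh n : ℤ) ≤ V := by exact_mod_cast hMV
    rw [abs_of_nonneg (by omega)]
    rw [numKeys_cast] at h₃
    omega
  refine .seq (.setIVar hs₁.bounded ?_)
  rw [hkeyE]
  have hrow₂ : ∀ q, RowOK γ I k (s₁.setI 5 (I.elemKey k)) q := fun q => (hrow₁ q).congr
    ⟨rfl, fun _ => rfl, fun _ _ => rfl, rfl⟩
  have hs₂ := hs₁.setI (r := 5) hv (by decide)
  -- After `l` rounds the top `l` keys are at stage `k + 1` and all lower ones at stage `k`. Rows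
  -- from `numKeys` on belong to no key, so they count as updated from the start.
  refine Runs.forUp (numKeys Kt Kh n) (fun l s' => Env rs V I w s' ∧ s'.ivar 10 = l ∧
    s'.ivar 3 = k ∧ s'.ivar 5 = I.elemKey k ∧
    (∀ j < Kt + Kh + 1, s'.ivar (20 + j) = I.entry k j) ∧
    (∀ q : ℤ, q < numKeys Kt Kh n - l → RowOK γ I k s' q) ∧
    (∀ q : ℤ, numKeys Kt Kh n - l ≤ q → RowOK γ I (k + 1) s' q)) hC hs₂.bounded ?_ ?_ ?_ ?_
  · refine ⟨hs₂.setI (by simp) (by decide), by simp, by simp [hk₁], by simp, ?_, ?_, ?_⟩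
    · intro j hj
      simp only [Mem.setI_ivar]
      rw [if_neg (by omega), if_neg (by omega), hent₁ j hj]
    · exact fun q _ => (hrow₂ q).congr ⟨rfl, fun _ => rfl, fun _ _ => rfl, rfl⟩
    · intro q hq
      refine RowOK.of_not_key _ ((hrow₂ q).congr ⟨rfl, fun _ => rfl, fun _ _ => rfl, rfl⟩)
        fun y hy => ?_
      have := I.key_lt y
      rw [← numKeys_cast] at this
      omega
  · rintro l s' hl ⟨h₁, h₂, -⟩
    exact ⟨h₁.bounded, h₂, by simp [IExp.val, h₁.keys_eq]⟩
  · rintro l s' hl ⟨h₁, h₂, h₃, h₄, h₅, h₆, h₇⟩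
    refine .seq (.setIVar h₁.bounded ?_)
    have hqv : (IExp.sub (.sub (.var 2) (.const 1)) (.var 10)).val s' =
        (numKeys Kt Kh n : ℤ) - 1 - l := by simp [IExp.val, h₂, h₁.keys_eq]
    obtain ⟨q, hq⟩ : ∃ q : ℤ, q = numKeys Kt Kh n - 1 - l := ⟨_, rfl⟩
    rw [hqv, ← hq]
    have hs₃ : Env rs V I w (s'.setI 4 q) := h₁.setI (by rw [abs_of_nonneg] <;> omega) (by decide)
    have hrow₃ : ∀ q' ≤ q, RowOK γ I k (s'.setI 4 q) q' := fun q' hq' =>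
      (h₆ q' (by omega)).congr ⟨rfl, fun _ => rfl, fun _ _ => rfl, rfl⟩
    have hv1 := I.one_le_elemKey k
    refine (runs_improve hC hV hs₃ (k := k) (q := q) (by simp [h₃]) (by simp) (by simp [h₄]) ?_
      (hrow₃ _ (by omega)) (hrow₃ _ le_rfl)).imp le_rfl ?_
    · intro j hj
      rw [Mem.setI_ivar, if_neg (by omega), h₅ j hj]
    · rintro s'' ⟨ha, hb, hc, hd⟩
      have hb' : ∀ r, r ≠ 6 → r ≠ 4 → s''.ivar r = s'.ivar r := fun r hr hr' => by
        rw [hb r hr, Mem.setI_ivar, if_neg hr']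
      have hsame : ∀ q', q' ≠ q → SameRow Kt Kh n s' (s''.setI 10 (l + 1)) q' := fun q' hq' =>
        ⟨(hd q' hq').flag, (hd q' hq').bits, (hd q' hq').comps, (hd q' hq').value⟩
      refine ⟨ha.bounded, by rw [hb' _ (by decide) (by decide), h₂],
        ha.setI (by rw [abs_of_nonneg] <;> omega) (by decide), by simp,
        by simp [hb', h₃], by simp [hb', h₄], ?_, ?_, ?_⟩
      · intro j hj
        rw [Mem.setI_ivar, if_neg (by omega), hb' _ (by omega) (by omega), h₅ j hj]
      · intro q' hq'
        push_cast at hq'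
        exact (h₆ q' (by omega)).congr (hsame q' (by omega))
      · intro q' hq'
        by_cases hqq : q' = q
        · subst hqq
          exact hc.congr ⟨rfl, fun _ => rfl, fun _ _ => rfl, rfl⟩
        · push_cast at hq'
          exact (h₇ q' (by omega)).congr (hsame q' hqq)
  · rintro s' ⟨h₁, -, h₃, -, -, h₆, h₇⟩
    refine ⟨h₁, h₃, fun q => ?_⟩
    -- Negative rows are never visited, but no solution has a negative key.
    by_cases hq : 0 ≤ q
    · exact h₇ q (by omega)
    · refine (h₆ q (by omega)).of_not_key _ fun y hy => ?_
      have := I.key_nonneg y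
      omega

def buildTime (Kt Kh n : ℕ) : ℕ := 1 + (1 + (1 + (n * (addElementTime Kt Kh n + 2) + 1)))

theorem bounded_input (hV : Fits rs V γ I) (hw : w ≤ n) : (I.input w).Bounded rs V := by
  have hnV := hV.lt
  have hK := hV.keys_le
  have h0 : rs 0 ≤ V := by rw [← sumObj_false I.f]; exact hV.sum_le _
  constructor
  · intro r
    simp only [Inst.input]
    split_ifs <;> simp <;> omega
  · intro a i
    simp only [Inst.input]
    split_ifs
    · unfold toArray
      split_ifs
      · rw [abs_of_nonneg (by positivity)]
        have := (I.catT ⟨i.toNat, by omega⟩).2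
        simp only
        omega
      · simp
    · unfold toArray
      split_ifs
      · rw [abs_of_nonneg (by positivity)]
        have := (I.catH ⟨i.toNat, by omega⟩).2
        simp only
        omega
      · simp
    · simp
  · exact fun _ => h0
  · intro a i
    simp only [Inst.input]
    split_ifs
    · unfold toArray
      split_ifs with h
      -- A single coefficient is the value of a one-element solution, so the bound on subset sums
      -- applies to it.
      · have h₁ := sumObj_update I.f (x := fun _ => false) (k := ⟨i.toNat, by omega⟩) rfl
        rw [sumObj_false, zero_add] at h₁
        rw [← h₁]
        exact hV.sum_le _
      · exact h0
    · exact h0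

theorem toArray_coe {A : Type} [Zero A] (v : Fin n → A) (i : Fin n) :
    toArray v (i : ℤ) = v i := by
  have : (0 : ℤ) ≤ (i : ℤ) ∧ (i : ℤ) < n := ⟨by positivity, by exact_mod_cast i.2⟩
  simp [toArray, this]

theorem runs_buildTable [IsOrderedAddMonoid F] (hC : SizeBound rs C) (hV : Fits rs V γ I)
    (hw : w ≤ n) :
    Runs rs C V (buildTable Kt Kh γ) (buildTime Kt Kh n) (I.input w) fun s' =>
      Env rs V I w s' ∧ ∀ q, RowOK γ I n s' q := by
  have hnV := hV.lt
  have hK := hV.keys_le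
  have hb := bounded_input hV hw
  refine .seq (.setIVar hb ?_)
  have hM : (powE (Kt + Kh + 1)).val (I.input w) = (numKeys Kt Kh n : ℕ) := by
    simp [powE_val, Inst.input, numKeys]
  rw [hM]
  have hb₁ : ((I.input w).setI 2 (numKeys Kt Kh n : ℕ)).Bounded rs V :=
    hb.setI _ (by rw [abs_of_nonneg (by positivity)]; exact_mod_cast (by omega))
  refine .seq (.setIArr hb₁ ?_)
  simp only [IExp.val]
  have hb₂ : (((I.input w).setI 2 (numKeys Kt Kh n : ℕ)).setIA 3 0 1).Bounded rs V :=
    hb₁.setIA _ _ (by simp; omega)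
  have hs₂ : Env rs V I w (((I.input w).setI 2 (numKeys Kt Kh n : ℕ)).setIA 3 0 1) := by
    refine ⟨hb₂, by simp [Inst.input], by simp [Inst.input], by simp,
      by simp [Inst.input], ?_, ?_, ?_⟩
    · intro i
      rw [Mem.setIA_iarr_ne _ _ _ _ _ (by decide)]
      simp [Inst.input, toArray_coe]
    · intro i
      rw [Mem.setIA_iarr_ne _ _ _ _ _ (by decide)]
      simp [Inst.input, toArray_coe]
    · intro i
      simp [Inst.input, toArray_coe]
  have hrow : ∀ q, RowOK γ I 0 (((I.input w).setI 2 (numKeys Kt Kh n : ℕ)).setIA 3 0 1) q := by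
    intro q
    -- At stage `0` only the empty solution is available. Its bits, components and value are the
    -- zeros of the initial memory, so only the flag of row `0` had to be set.
    have huniq : ∀ y : Sol n, SuppBelow 0 y → y = fun _ => false := fun y hy =>
      funext fun i => hy i (by omega)
    by_cases hq : q = 0
    · subst hq
      refine Or.inr ⟨fun _ => false, ⟨by simp [Mem.setIA_iarr], ?_, ?_, ?_⟩, fun _ _ => rfl,
        I.key_false, fun y hy _ => by rw [huniq y hy]⟩
      · intro i
        rw [Mem.setIA_iarr_ne _ _ _ _ _ (by decide)]
        simp [Inst.input, bit]
      · intro j _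
        rw [Mem.setIA_iarr_ne _ _ _ _ _ (by omega), I.comp_false]
        simp only [Mem.setI_iarr, Inst.input]
        rw [if_neg (by omega), if_neg (by omega)]
      · simp [Inst.input, sumObj_false]
    · refine Or.inl ⟨?_, fun y hy => ?_⟩
      · rw [Mem.setIA_iarr, if_neg (by tauto)]
        simp [Inst.input]
      · rw [huniq y hy, I.key_false]
        exact fun h => hq h.symm
  refine Runs.forUp n (fun k s' => Env rs V I w s' ∧ s'.ivar 3 = k ∧ ∀ q, RowOK γ I k s' q) hC hb₂
    ?_ ?_ ?_ ?_
  · exact ⟨hs₂.setI (by simp) (by decide), by simp, fun q => (hrow q).congr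
      ⟨rfl, fun _ => rfl, fun _ _ => rfl, rfl⟩⟩
  · rintro k s' - ⟨h₁, h₂, -⟩
    exact ⟨h₁.bounded, h₂, by simp [IExp.val, h₁.n_eq]⟩
  · rintro k s' hk ⟨h₁, h₂, h₃⟩
    refine (runs_addElement (k := ⟨k, hk⟩) hC hV h₁ h₂ h₃).imp le_rfl ?_
    rintro s'' ⟨h₄, h₅, h₆⟩
    refine ⟨h₄.bounded, h₅, h₄.setI (by rw [abs_of_nonneg] <;> omega) (by decide), by simp, ?_⟩
    exact fun q => (h₆ q).congr ⟨rfl, fun _ => rfl, fun _ _ => rfl, rfl⟩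
  · rintro s' ⟨h₁, -, h₃⟩
    exact ⟨h₁, h₃⟩

end Build

/-! ### Selecting the efficient solutions from the table -/

/-- The conjunction of `f 0, …, f (m - 1)`. -/
def allRange (f : ℕ → BExp) : ℕ → BExp
  | 0 => .leI (.const 0) (.const 0)
  | m + 1 => .and (allRange f m) (f m)

/-- The row whose key is in register `r` contains a feasible solution. (The cardinality constraint
is present if `κ = 1`, and absent if `κ = 0`.) -/
def feasTest (Kt Kh : ℕ) (κ : ℤ) (r : ℕ) : BExp :=
  .and (.leI (.const 1) (.arr 3 (.var r)))
    (.and (.leI (.mul (.const κ) (.sub (.arr (11 + (Kt + Kh)) (.var r)) (.var 1))) (.const 0))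
      (.leI (.const 0) (.mul (.const κ) (.sub (.arr (11 + (Kt + Kh)) (.var r)) (.var 1)))))

/-- The outcome of the row with key in register `r` is at most the one for register `r'`. -/
def outcomeLeTest (Kt Kh : ℕ) (α β γ : ℤ) (r r' : ℕ) : BExp :=
  .and (allRange (fun j => .leI (.mul (.const α) (.arr (11 + j) (.var r)))
      (.mul (.const α) (.arr (11 + j) (.var r')))) Kt)
    (.and (allRange (fun j => .leI (.mul (.const β) (.arr (11 + Kt + j) (.var r)))
        (.mul (.const β) (.arr (11 + Kt + j) (.var r')))) Kh)
      (.leR (.mul (.ofInt (.const γ)) (.arr 1 (.var r)))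
        (.mul (.ofInt (.const γ)) (.arr 1 (.var r')))))

def beatsTest (Kt Kh : ℕ) (α β γ κ : ℤ) : BExp :=
  .and (feasTest Kt Kh κ 7) (.and (outcomeLeTest Kt Kh α β γ 7 4)
    (.not (.and (outcomeLeTest Kt Kh α β γ 4 7) (.leI (.var 4) (.var 7)))))

/-- Writes `c` times the components `off - 11, …, off - 11 + K - 1` of the current row to the next
free block of `K` cells of the array `dst`. -/
def writeBlock (dst off K : ℕ) (c : ℤ) : Prog :=
  seqRange (fun j => .setIArr dst (.add (.mul (.var 9) (.const K)) (.const j))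
    (.mul (.const c) (.arr (off + j) (.var 4)))) K

def writeRow (Kt Kh : ℕ) (α β γ : ℤ) : Prog :=
  .seq (copyBlock 0 4 (.mul (.var 9) (.var 0)) (.mul (.var 4) (.var 0)))
  (.seq (writeBlock 1 11 Kt α)
  (.seq (writeBlock 2 (11 + Kt) Kh β)
  (.seq (.setRArr 0 (.var 9) (.mul (.ofInt (.const γ)) (.arr 1 (.var 4))))
  (.setIVar 9 (.add (.var 9) (.const 1))))))

def scanRow (Kt Kh : ℕ) (α β γ κ : ℤ) : Prog :=
  .ite (feasTest Kt Kh κ 4)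
    (.seq (.setIVar 8 (.const 1))
    (.seq (forUp 7 (.var 2) (.ite (beatsTest Kt Kh α β γ κ) (.setIVar 8 (.const 0)) .skip))
    (.ite (.leI (.const 1) (.var 8)) (writeRow Kt Kh α β γ) .skip)))
    .skip

/-- The output overwrites the input arrays, which are no longer needed: the scan reads only the
table and the registers. Registers `0` and `1` still hold `n` and `w` during the scan and receive
the output count only at the end. -/
def scanTable (Kt Kh : ℕ) (α β γ κ : ℤ) : Prog :=
  .seq (forUp 4 (.var 2) (scanRow Kt Kh α β γ κ))
  (.seq (.setIVar 0 (.var 9)) (.setIVar 1 (.var 9)))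

section ScanFrame

variable {F : Type} {rs : F → ℕ} {V : ℕ} {s s₁ : Mem F}

/-- The parts of the memory `s₁` that do not change while the table is scanned. -/
structure Scan (rs : F → ℕ) (V : ℕ) (s₁ s : Mem F) : Prop where
  bounded : s.Bounded rs V
  ivar_eq : ∀ r < 3, s.ivar r = s₁.ivar r
  iarr_eq : ∀ a, 3 ≤ a → s.iarr a = s₁.iarr a
  rarr_eq : s.rarr 1 = s₁.rarr 1

theorem Scan.setI (h : Scan rs V s₁ s) {r : ℕ} {v : ℤ} (hv : |v| ≤ V) (hr : 3 ≤ r) :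
    Scan rs V s₁ (s.setI r v) where
  bounded := h.bounded.setI r hv
  ivar_eq r' hr' := by rw [Mem.setI_ivar, if_neg (by omega), h.ivar_eq r' hr']
  iarr_eq := h.iarr_eq
  rarr_eq := h.rarr_eq

end ScanFrame

/-! ### Correctness of the pairwise comparison and of the output -/

section Scan

variable {F : Type} [Ring F] [LinearOrder F] {Kt Kh n : ℕ} {rs : F → ℕ} {C V : ℕ}
  {I : Inst F Kt Kh n} {w : ℕ} {s s₁ : Mem F} {α β γ κ : ℤ} {x : ℕ → Sol n}

theorem allRange_holds (f : ℕ → BExp) (m : ℕ) :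
    (allRange f m).Holds s ↔ ∀ j < m, (f j).Holds s := by
  induction m with
  | zero => simp [allRange, BExp.Holds]
  | succ m ih =>
    simp only [allRange, BExp.Holds, ih]
    constructor
    · rintro ⟨h₁, h₂⟩ j hj
      rcases Nat.lt_succ_iff_lt_or_eq.1 hj with h | rfl
      exacts [h₁ j h, h₂]
    · exact fun h => ⟨fun j hj => h j (by omega), h m (by omega)⟩

/-- The nonempty rows of the table in `s` contain the solutions `x q`. -/
def HasRows (I : Inst F Kt Kh n) (s : Mem F) (x : ℕ → Sol n) : Prop :=
  ∀ q : ℕ, s.iarr 3 q = 0 ∨ IsRow I s q (x q)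

theorem HasRows.scan (h : HasRows I s₁ x) (hs : Scan rs V s₁ s) : HasRows I s x := by
  intro q
  rw [hs.iarr_eq 3 le_rfl]
  refine (h q).imp_right fun hq => hq.congr ⟨?_, fun i => ?_, fun j _ => ?_, ?_⟩
  · rw [hs.iarr_eq 3 (by omega)]
  · rw [hs.iarr_eq 4 (by omega)]
  · rw [hs.iarr_eq (11 + j) (by omega)]
  · rw [hs.rarr_eq]

/-- The keys of the rows with feasible solutions. -/
def feasRows (I : Inst F Kt Kh n) (s : Mem F) (w : ℕ) (κ : ℤ) (x : ℕ → Sol n) : Set ℕ :=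
  {q | q < numKeys Kt Kh n ∧ s.iarr 3 q = 1 ∧ κ * (I.comp (x q) (Kt + Kh) - w) = 0}

theorem feasTest_holds {r q : ℕ} (hx : HasRows I s₁ x) (hw : s₁.ivar 1 = w) (hs : Scan rs V s₁ s)
    (hr : s.ivar r = q) (hq : q < numKeys Kt Kh n) :
    (feasTest Kt Kh κ r).Holds s ↔ q ∈ feasRows I s₁ w κ x := by
  simp only [feasTest, BExp.Holds, IExp.val, hr, hs.ivar_eq 1 (by omega), hw,
    hs.iarr_eq 3 le_rfl, hs.iarr_eq (11 + (Kt + Kh)) (by omega), feasRows, Set.mem_ofPred_eq]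
  rcases hx q with h | h
  · simp [h]
  · rw [h.flag, h.comps (Kt + Kh) (by omega)]
    constructor
    · rintro ⟨-, h₁, h₂⟩
      exact ⟨hq, rfl, le_antisymm h₁ h₂⟩
    · rintro ⟨-, -, h₁⟩
      exact ⟨le_rfl, h₁.le, h₁.ge⟩

theorem outcomeLeTest_holds {r r' : ℕ} {q q' : ℤ} {y y' : Sol n} (hr : s.ivar r = q)
    (hr' : s.ivar r' = q') (hy : IsRow I s q y) (hy' : IsRow I s q' y') :
    (outcomeLeTest Kt Kh α β γ r r').Holds s ↔ outcome α β γ I y ≤ outcome α β γ I y' := by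
  simp only [outcomeLeTest, BExp.Holds, allRange_holds, IExp.val, RExp.val, hr, hr', hy.value,
    hy'.value, outcome, Prod.mk_le_mk, Pi.le_def, I.countVec_catT, I.countVec_catH]
  refine and_congr ?_ (and_congr ?_ Iff.rfl)
  · constructor
    · intro h j
      simpa only [hy.comps j (by omega), hy'.comps j (by omega)] using h j j.2
    · intro h j hj
      rw [hy.comps j (by omega), hy'.comps j (by omega)]
      exact h ⟨j, hj⟩
  · constructor
    · intro h j
      simpa only [add_assoc, hy.comps (Kt + j) (by omega), hy'.comps (Kt + j) (by omega)]
        using h j j.2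
    · intro h j hj
      rw [add_assoc, hy.comps (Kt + j) (by omega), hy'.comps (Kt + j) (by omega)]
      exact h ⟨j, hj⟩

/-- The comparison of outcomes is meaningful only for nonempty rows; for row `q'` this is supplied
by the feasibility test in the same conjunction. -/
theorem beatsTest_holds {q q' : ℕ} (hx : HasRows I s₁ x) (hw : s₁.ivar 1 = w)
    (hs : Scan rs V s₁ s) (h7 : s.ivar 7 = q') (h4 : s.ivar 4 = q) (hq' : q' < numKeys Kt Kh n)
    (hq : IsRow I s q (x q)) :
    (beatsTest Kt Kh α β γ κ).Holds s ↔
      q' ∈ feasRows I s₁ w κ x ∧ Beats (fun q => outcome α β γ I (x q)) q' q := by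
  simp only [beatsTest, BExp.Holds]
  rw [feasTest_holds hx hw hs h7 hq']
  refine and_congr_right fun hmem => ?_
  have hrow : IsRow I s q' (x q') := by
    refine (hx.scan hs q').resolve_left ?_
    rw [hs.iarr_eq 3 le_rfl, hmem.2.1]
    decide
  rw [outcomeLeTest_holds h7 h4 hrow hq, outcomeLeTest_holds h4 h7 hq hrow]
  simp [Beats, IExp.val, h7, h4]

/-- The output arrays contain the solutions `x q` and their outcomes, for the keys `q` in `l`. -/
structure Written (α β γ : ℤ) (I : Inst F Kt Kh n) (x : ℕ → Sol n) (l : List ℕ) (s : Mem F) :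
    Prop where
  count : s.ivar 9 = l.length
  bits : ∀ (t : ℕ) (ht : t < l.length) (i : Fin n), s.iarr 0 ((t : ℤ) * n + i) = bit (x l[t]) i
  fst : ∀ (t : ℕ) (ht : t < l.length) (j : Fin Kt),
    s.iarr 1 ((t : ℤ) * Kt + j) = (outcome α β γ I (x l[t])).1 j
  snd : ∀ (t : ℕ) (ht : t < l.length) (j : Fin Kh),
    s.iarr 2 ((t : ℤ) * Kh + j) = (outcome α β γ I (x l[t])).2.1 j
  value : ∀ (t : ℕ) (ht : t < l.length), s.rarr 0 t = (outcome α β γ I (x l[t])).2.2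

theorem Written.setI {l : List ℕ} (h : Written α β γ I x l s) {r : ℕ} {v : ℤ} (hr : r ≠ 9) :
    Written α β γ I x l (s.setI r v) where
  count := by rw [Mem.setI_ivar, if_neg (by omega), h.count]
  bits := h.bits
  fst := h.fst
  snd := h.snd
  value := h.value

theorem runs_writeBlock {dst off K N : ℕ} {c q : ℤ} {Q : Mem F → Prop} (hs : s.Bounded rs V)
    (h4 : s.ivar 4 = q) (h9 : s.ivar 9 = N) (hoff : dst < off)
    (hV : ∀ j < K, |c * s.iarr (off + j) q| ≤ V)
    (hQ : ∀ s' : Mem F, s'.Bounded rs V → s'.ivar = s.ivar → s'.rarr = s.rarr →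
      (∀ a, a ≠ dst → s'.iarr a = s.iarr a) →
      (∀ j < K, s'.iarr dst ((N : ℤ) * K + j) = c * s.iarr (off + j) q) →
      (∀ a, a < (N : ℤ) * K → s'.iarr dst a = s.iarr dst a) → Q s') :
    Runs rs C V (writeBlock dst off K c) (1 + K * 1) s Q := by
  refine .seqRange K (fun m s' => s'.Bounded rs V ∧ s'.ivar = s.ivar ∧ s'.rarr = s.rarr ∧
      (∀ a, a ≠ dst → s'.iarr a = s.iarr a) ∧
      (∀ j < m, s'.iarr dst ((N : ℤ) * K + j) = c * s.iarr (off + j) q) ∧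
      (∀ a, a < (N : ℤ) * K → s'.iarr dst a = s.iarr dst a))
    ⟨hs, rfl, rfl, fun _ _ => rfl, by simp, fun _ _ => rfl⟩ ?_ ?_
  · rintro m s' hm ⟨h₁, h₂, h₃, h₄, h₅, h₆⟩
    refine .setIArr h₁ ?_
    simp only [IExp.val, h₂, h4, h9, h₄ (off + m) (by omega)]
    refine ⟨h₁.setIA _ _ (hV m hm), h₂, h₃, ?_, ?_, ?_⟩
    · intro a ha
      rw [Mem.setIA_iarr_ne _ _ _ _ _ ha, h₄ a ha]
    · intro j hj
      rw [Mem.setIA_iarr]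
      by_cases hjm : j = m
      · subst hjm; simp
      · rw [if_neg (by omega), h₅ j (by omega)]
    · intro a ha
      rw [Mem.setIA_iarr, if_neg (by omega), h₆ a ha]
  · rintro s' ⟨h₁, h₂, h₃, h₄, h₅, h₆⟩
    exact hQ s' h₁ h₂ h₃ h₄ h₅ h₆

theorem block_lt {t N K : ℕ} {j : ℤ} (ht : t < N) (hj : j < K) :
    (t : ℤ) * K + j < N * K := by
  have : ((t : ℤ) + 1) * K ≤ N * K :=
    mul_le_mul_of_nonneg_right (by exact_mod_cast ht) (by positivity)
  linarith

def writeTime (Kt Kh n : ℕ) : ℕ :=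
  (1 + (n * (1 + 2) + 1)) + ((1 + Kt * 1) + ((1 + Kh * 1) + (1 + 1)))

theorem abs_mul_comp_le (hV : Fits rs V γ I) {c : ℤ} (hc : |c| ≤ 1) (y : Sol n) (j : ℕ) :
    |c * I.comp y j| ≤ V := by
  have h₁ := I.comp_nonneg y j
  have h₂ := I.comp_le y j
  have h₃ := hV.lt
  rw [abs_mul, abs_of_nonneg h₁]
  nlinarith

theorem runs_writeRow {l : List ℕ} {q : ℕ} (hC : SizeBound rs C) (hV : Fits rs V γ I)
    (hα : |α| ≤ 1) (hβ : |β| ≤ 1) (hn : s₁.ivar 0 = n) (hs : Scan rs V s₁ s)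
    (hW : Written α β γ I x l s) (hl : l.length < V) (h4 : s.ivar 4 = q)
    (hq : IsRow I s q (x q)) :
    Runs rs C V (writeRow Kt Kh α β γ) (writeTime Kt Kh n) s fun s' =>
      Scan rs V s₁ s' ∧ s'.ivar 4 = q ∧ Written α β γ I x (l ++ [q]) s' := by
  have hnV := hV.lt
  have hn' : s.ivar 0 = n := by rw [hs.ivar_eq 0 (by omega), hn]
  refine .seq (runs_copyBlock (d := (l.length : ℤ) * n) (e := (q : ℤ) * n) hC hs.bounded hn' hnV.le
    ?_ ?_ (Or.inl (by decide)) ?_)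
  · intro s' h
    simp [IExp.val, h, hW.count, hn']
  · intro s' h
    simp [IExp.val, h, h4, hn']
  intro s₂ hb₂ hi₂ hr₂ ha₂ hc₂ ho₂
  refine .seq (runs_writeBlock (q := q) (N := l.length) hb₂ (by rw [hi₂ _ (by decide), h4])
    (by rw [hi₂ _ (by decide), hW.count]) (by omega) ?_ ?_)
  · intro j hj
    rw [ha₂ _ (by omega), hq.comps j (by omega)]
    exact abs_mul_comp_le hV hα _ _
  intro s₃ hb₃ hi₃ hr₃ ha₃ hc₃ ho₃
  refine .seq (runs_writeBlock (q := q) (N := l.length) hb₃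
    (by rw [hi₃, hi₂ _ (by decide), h4]) (by rw [hi₃, hi₂ _ (by decide), hW.count]) (by omega) ?_ ?_)
  · intro j hj
    rw [ha₃ _ (by omega), ha₂ _ (by omega), add_assoc, hq.comps (Kt + j) (by omega)]
    exact abs_mul_comp_le hV hβ _ _
  intro s₄ hb₄ hi₄ hr₄ ha₄ hc₄ ho₄
  have hi : ∀ r, r ≠ 6 → s₄.ivar r = s.ivar r := fun r hr => by rw [hi₄, hi₃, hi₂ r hr]
  have hr : s₄.rarr = s.rarr := by rw [hr₄, hr₃, hr₂]
  have hval : (RExp.mul (.ofInt (.const γ)) (.arr 1 (.var 4))).val s₄ =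
      (γ : F) * sumObj I.f (x q) := by
    simp [RExp.val, IExp.val, hi, h4, hr, hq.value]
  have hb₅ : (s₄.setRA 0 l.length ((γ : F) * sumObj I.f (x q))).Bounded rs V :=
    hb₄.setRA _ _ (hV.mul_sum_le _)
  refine .seq (.setRArr hC hb₄ (.setIVar ?_ ?_))
  · rw [hval, show (IExp.var 9).val s₄ = l.length by simp [IExp.val, hi, hW.count]]
    exact hb₅
  rw [hval]
  simp only [IExp.val, hi 9 (by decide), hW.count, Mem.setRA_ivar]
  refine ⟨⟨hb₅.setI _ (by rw [abs_of_nonneg] <;> omega), ?_, ?_, ?_⟩, ?_, ⟨?_, ?_, ?_, ?_, ?_⟩⟩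
  · intro r hr
    rw [Mem.setI_ivar, if_neg (by omega), Mem.setRA_ivar, hi r (by omega), hs.ivar_eq r hr]
  · intro a ha
    rw [Mem.setI_iarr, Mem.setRA_iarr, ha₄ a (by omega), ha₃ a (by omega), ha₂ a (by omega),
      hs.iarr_eq a ha]
  · rw [Mem.setI_rarr, Mem.setRA_rarr_ne _ _ _ _ _ (by decide), hr, hs.rarr_eq]
  · simp [hi, h4]
  · simp
  · intro t ht i
    simp only [Mem.setI_iarr, Mem.setRA_iarr]
    rw [ha₄ 0 (by decide), ha₃ 0 (by decide)]
    rw [List.length_append, List.length_singleton] at ht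
    by_cases h : t < l.length
    · rw [List.getElem_append_left h, ho₂ _ (Or.inl (block_lt h (by exact_mod_cast i.2))),
        hW.bits t h]
    · obtain rfl : t = l.length := by omega
      rw [List.getElem_concat_length rfl, hc₂, hq.bits]
  · intro t ht j
    simp only [Mem.setI_iarr, Mem.setRA_iarr]
    rw [ha₄ 1 (by decide)]
    rw [List.length_append, List.length_singleton] at ht
    by_cases h : t < l.length
    · rw [List.getElem_append_left h, ho₃ _ (block_lt h (by exact_mod_cast j.2)),
        ha₂ 1 (by decide), hW.fst t h]
    · obtain rfl : t = l.length := by omega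
      rw [List.getElem_concat_length rfl, hc₃ j j.2, ha₂ _ (by omega), hq.comps j (by omega)]
      simp only [outcome, I.countVec_catT]
  · intro t ht j
    simp only [Mem.setI_iarr, Mem.setRA_iarr]
    rw [List.length_append, List.length_singleton] at ht
    by_cases h : t < l.length
    · rw [List.getElem_append_left h, ho₄ _ (block_lt h (by exact_mod_cast j.2)),
        ha₃ 2 (by decide), ha₂ 2 (by decide), hW.snd t h]
    · obtain rfl : t = l.length := by omega
      rw [List.getElem_concat_length rfl, hc₄ j j.2, ha₃ _ (by omega), ha₂ _ (by omega), add_assoc,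
        hq.comps (Kt + j) (by omega)]
      simp only [outcome, I.countVec_catH]
  · intro t ht
    simp only [Mem.setI_rarr]
    rw [List.length_append, List.length_singleton] at ht
    rw [Mem.setRA_rarr]
    by_cases h : t < l.length
    · rw [List.getElem_append_left h, if_neg (by omega), hr, hW.value t h]
    · obtain rfl : t = l.length := by omega
      rw [List.getElem_concat_length rfl, if_pos ⟨rfl, rfl⟩]
      rfl

def scanRowTime (Kt Kh n : ℕ) : ℕ :=
  (1 + ((1 + (numKeys Kt Kh n * ((1 + 1) + 2) + 1)) + (writeTime Kt Kh n + 1))) + 1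

theorem runs_scanRow {q : ℕ} (hC : SizeBound rs C) (hV : Fits rs V γ I)
    (hα : |α| ≤ 1) (hβ : |β| ≤ 1) (hn : s₁.ivar 0 = n) (hw : s₁.ivar 1 = w)
    (hM : s₁.ivar 2 = numKeys Kt Kh n) (hx : HasRows I s₁ x) (hs : Scan rs V s₁ s)
    (hq : q < numKeys Kt Kh n) (h4 : s.ivar 4 = q)
    (hW : Written α β γ I x
      (keptBelow (feasRows I s₁ w κ x) (fun q => outcome α β γ I (x q)) q) s) :
    Runs rs C V (scanRow Kt Kh α β γ κ) (scanRowTime Kt Kh n) s fun s' =>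
      Scan rs V s₁ s' ∧ s'.ivar 4 = q ∧ Written α β γ I x
        (keptBelow (feasRows I s₁ w κ x) (fun q => outcome α β γ I (x q)) (q + 1)) s' := by
  classical
  have hMV : numKeys Kt Kh n ≤ V := by have := hV.keys_le; omega
  -- At most one solution per earlier key has been written, so the output counter stays below the
  -- memory bound even after its increment.
  have hlen : (keptBelow (feasRows I s₁ w κ x) (fun q => outcome α β γ I (x q)) q).length < V :=
    ((List.length_filter_le _ _).trans (by simp)).trans_lt (hq.trans_le hMV)
  have hskip : ∀ (s' : Mem F) (T : ℕ), 1 ≤ T → Scan rs V s₁ s' → s'.ivar 4 = q →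
      Written α β γ I x
        (keptBelow (feasRows I s₁ w κ x) (fun q => outcome α β γ I (x q)) q) s' →
      ¬ Kept (feasRows I s₁ w κ x) (fun q => outcome α β γ I (x q)) q →
      Runs rs C V .skip T s' fun s' =>
      Scan rs V s₁ s' ∧ s'.ivar 4 = q ∧ Written α β γ I x
        (keptBelow (feasRows I s₁ w κ x) (fun q => outcome α β γ I (x q)) (q + 1)) s' := by
    intro s' T hT h₁ h₂ h₃ h₄
    refine (Runs.skip ⟨h₁, h₂, ?_⟩).imp hT fun _ h => h
    rwa [keptBelow_succ, if_neg h₄, List.append_nil]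
  refine .ite hC hs.bounded (fun h => ?_) (fun h => ?_)
  · rw [feasTest_holds hx hw hs h4 hq] at h
    have hrow : ∀ s', Scan rs V s₁ s' → IsRow I s' q (x q) := fun s' hs' => by
      refine (hx.scan hs' q).resolve_left ?_
      rw [hs'.iarr_eq 3 le_rfl, h.2.1]
      decide
    have h1V : (1 : ℤ) ≤ V := by have := hV.lt; omega
    refine .seq (.setIVar hs.bounded ?_)
    have hs₂ : Scan rs V s₁ (s.setI 8 1) := hs.setI (by simpa using h1V) (by omega)
    -- The flag in register `8` is `1` as long as no feasible row below `p` beats row `q`; once it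
    -- is `0`, some feasible row does, and it is never set back.
    refine .seq (Runs.forUp (numKeys Kt Kh n) (fun p s' => Scan rs V s₁ s' ∧ s'.ivar 7 = p ∧
      s'.ivar 4 = q ∧ Written α β γ I x
        (keptBelow (feasRows I s₁ w κ x) (fun q => outcome α β γ I (x q)) q) s' ∧
      ((s'.ivar 8 = 1 ∧ ∀ q' < p, q' ∈ feasRows I s₁ w κ x →
          ¬ Beats (fun q => outcome α β γ I (x q)) q' q) ∨
        (s'.ivar 8 = 0 ∧ ∃ q' ∈ feasRows I s₁ w κ x,
          Beats (fun q => outcome α β γ I (x q)) q' q))) hC hs₂.bounded ?_ ?_ ?_ ?_)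
    · exact ⟨hs₂.setI (by simp) (by omega), by simp, by simp [h4],
        (hW.setI (by decide)).setI (by decide), Or.inl (by simp [IExp.val])⟩
    · rintro p s' - ⟨h₁, h₂, -⟩
      exact ⟨h₁.bounded, h₂, by simp [IExp.val, h₁.ivar_eq 2, hM]⟩
    · rintro p s' hp ⟨h₁, h₂, h₃, h₄, h₅⟩
      have hpV : |(p : ℤ) + 1| ≤ V := by rw [abs_of_nonneg] <;> omega
      refine .ite hC h₁.bounded (fun hb => ?_) (fun hb => ?_)
      · rw [beatsTest_holds hx hw h₁ h₂ h₃ hp (hrow s' h₁)] at hb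
        have h₁' : Scan rs V s₁ (s'.setI 8 0) := h₁.setI (by simp) (by omega)
        refine .setIVar h₁.bounded ⟨h₁'.bounded, by simp [h₂], h₁'.setI hpV (by omega), by simp,
          by simp [h₃], (h₄.setI (by decide)).setI (by decide), Or.inr ?_⟩
        exact ⟨by simp [IExp.val], p, hb⟩
      · rw [beatsTest_holds hx hw h₁ h₂ h₃ hp (hrow s' h₁)] at hb
        refine .skip ⟨h₁.bounded, h₂, h₁.setI hpV (by omega), by simp,
          by simp [h₃], h₄.setI (by decide), ?_⟩
        rcases h₅ with ⟨h₅, h₆⟩ | ⟨h₅, h₆⟩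
        · refine Or.inl ⟨by simp [h₅], fun q' hq' hmem => ?_⟩
          rcases Nat.lt_succ_iff_lt_or_eq.1 hq' with hlt | rfl
          · exact h₆ q' hlt hmem
          · exact fun hbe => hb ⟨hmem, hbe⟩
        · exact Or.inr ⟨by simp [h₅], h₆⟩
    · rintro s' ⟨h₁, -, h₃, h₄, h₅⟩
      refine .ite hC h₁.bounded (fun hb => ?_) (fun hb => ?_)
      · simp only [BExp.Holds, IExp.val] at hb
        have hk : Kept (feasRows I s₁ w κ x) (fun q => outcome α β γ I (x q)) q := by
          rcases h₅ with ⟨-, h₆⟩ | ⟨h₅, -⟩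
          · exact ⟨h, fun q' hq' => h₆ q' hq'.1 hq'⟩
          · omega
        rw [keptBelow_succ, if_pos hk]
        exact runs_writeRow hC hV hα hβ hn h₁ h₄ hlen h₃ (hrow s' h₁)
      · simp only [BExp.Holds, IExp.val] at hb
        refine hskip s' _ (by unfold writeTime; omega) h₁ h₃ h₄ fun hk => ?_
        rcases h₅ with ⟨h₅, -⟩ | ⟨-, q', hq', hbe⟩
        · omega
        · exact hk.2 q' hq' hbe
  · rw [feasTest_holds hx hw hs h4 hq] at h
    exact hskip s _ (by omega) hs h4 hW fun hk => h hk.1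

def scanTime (Kt Kh n : ℕ) : ℕ :=
  (1 + (numKeys Kt Kh n * (scanRowTime Kt Kh n + 2) + 1)) + (1 + 1)

theorem runs_scanTable (hC : SizeBound rs C) (hV : Fits rs V γ I)
    (hα : |α| ≤ 1) (hβ : |β| ≤ 1) (hs : Env rs V I w s) (hx : HasRows I s x) :
    Runs rs C V (scanTable Kt Kh α β γ κ) (scanTime Kt Kh n) s fun s' =>
      Written α β γ I x (keptBelow (feasRows I s w κ x) (fun q => outcome α β γ I (x q))
        (numKeys Kt Kh n)) s' ∧ s'.ivar 0 = s'.ivar 9 ∧ s'.ivar 1 = s'.ivar 9 := by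
  have hMV : numKeys Kt Kh n ≤ V := by have := hV.keys_le; omega
  have hs₀ : Scan rs V s s := ⟨hs.bounded, fun _ _ => rfl, fun _ _ => rfl, rfl⟩
  refine .seq (Runs.forUp (numKeys Kt Kh n) (fun q s' => Scan rs V s s' ∧ s'.ivar 4 = q ∧
    Written α β γ I x (keptBelow (feasRows I s w κ x) (fun q => outcome α β γ I (x q)) q) s')
    hC hs.bounded ?_ ?_ ?_ ?_)
  · exact ⟨hs₀.setI (by simp) (by omega), by simp,
      by simp [keptBelow, hs.count_eq], by simp [keptBelow], by simp [keptBelow],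
      by simp [keptBelow], by simp [keptBelow]⟩
  · rintro q s' - ⟨h₁, h₂, -⟩
    exact ⟨h₁.bounded, h₂, by simp [IExp.val, h₁.ivar_eq 2, hs.keys_eq]⟩
  · rintro q s' hq ⟨h₁, h₂, h₃⟩
    refine (runs_scanRow hC hV hα hβ hs.n_eq hs.w_eq hs.keys_eq hx h₁ hq h₂ h₃).imp le_rfl ?_
    rintro s'' ⟨h₄, h₅, h₆⟩
    exact ⟨h₄.bounded, h₅, h₄.setI (by rw [abs_of_nonneg] <;> omega) (by omega), by simp,
      h₆.setI (by decide)⟩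
  · rintro s' ⟨h₁, -, h₃⟩
    refine .seq (.setIVar h₁.bounded (.setIVar (h₁.bounded.setI _ (h₁.bounded.ivar_le 9)) ?_))
    exact ⟨(h₃.setI (by decide)).setI (by decide), by simp [IExp.val], by simp [IExp.val]⟩

end Scan

/-! ### The algorithm -/

/-- The program for the problem with (`κ = 1`) or without (`κ = 0`) cardinality constraint. -/
def solver (Kt Kh : ℕ) (α β γ κ : ℤ) : Prog :=
  .seq (buildTable Kt Kh γ) (scanTable Kt Kh α β γ κ)

section Correctness

variable {F : Type} [Ring F] [LinearOrder F] {Kt Kh n : ℕ} {rs : F → ℕ} {C V : ℕ}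
  {I : Inst F Kt Kh n} {w : ℕ} {s : Mem F} {α β γ κ : ℤ} {x : ℕ → Sol n}

/-- The feasible set of the problem with (`κ = 1`) or without (`κ = 0`) cardinality constraint. -/
def feasible (n w : ℕ) (κ : ℤ) : Set (Sol n) := {y | κ * (∑ i, bit y i - w) = 0}

theorem feasible_zero (n w : ℕ) : feasible n w 0 = Set.univ := by
  ext y; simp [feasible]

theorem feasible_one (n w : ℕ) : feasible n w 1 = cardFeasible n w := by
  ext y; simp [feasible, cardFeasible, sub_eq_zero]

/-- Equal keys give equal counting vectors, so only the sum objective remains to be compared. -/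
theorem outcome_le_of_key_eq {y y' : Sol n} (hkey : I.key y = I.key y')
    (hle : (γ : F) * sumObj I.f y ≤ γ * sumObj I.f y') :
    outcome α β γ I y ≤ outcome α β γ I y' := by
  refine ⟨fun j => ?_, fun j => ?_, hle⟩
  · simp only [outcome, I.countVec_catT, I.comp_eq_of_key_eq hkey (j := j) (by omega), le_refl]
  · simp only [outcome, I.countVec_catH, I.comp_eq_of_key_eq hkey (j := Kt + j) (by omega), le_refl]

theorem isCorrectOutput_of_written {A : Set ℕ} {M : ℕ} {X : Set (Sol n)}
    (hx : ∀ y ∈ X, ∃ q ∈ A, outcome α β γ I (x q) ≤ outcome α β γ I y) (hA : ∀ q ∈ A, x q ∈ X)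
    (hM : ∀ q ∈ A, q < M)
    (hW : Written α β γ I x (keptBelow A (fun q => outcome α β γ I (x q)) M) s)
    (h0 : s.ivar 0 = s.ivar 9) (h1 : s.ivar 1 = s.ivar 9) :
    IsCorrectOutput X (outcome α β γ I) s := by
  set l := keptBelow A (fun q => outcome α β γ I (x q)) M with hl
  have hkept : ∀ t : Fin l.length, Kept A (fun q => outcome α β γ I (x q)) l[t] := fun t =>
    (mem_keptBelow.1 (List.getElem_mem t.2)).2
  have hinj : Function.Injective fun t : Fin l.length => outcome α β γ I (x l[t]) := by
    intro t t' h
    have := (hkept t).eq_of_eq (hkept t') h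
    exact Fin.ext ((keptBelow_nodup _ _ _).getElem_inj_iff.1 this)
  have hrange : ∀ {B : Type} (g : ℕ → B), Set.range (fun t : Fin l.length => g l[t]) =
      g '' {q | Kept A (fun q => outcome α β γ I (x q)) q} := by
    intro B g
    ext v
    constructor
    · rintro ⟨t, rfl⟩
      exact ⟨_, hkept t, rfl⟩
    · rintro ⟨q, hq, rfl⟩
      obtain ⟨t, ht, rfl⟩ := List.mem_iff_getElem.1 (mem_keptBelow.2 ⟨hM q hq.1, hq⟩ : q ∈ l)
      exact ⟨⟨t, ht⟩, rfl⟩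
  refine ⟨⟨l.length, fun t => outcome α β γ I (x l[t]), hinj, ?_, ?_, ?_, ?_, ?_⟩, _,
    isMinimalComplete_image hx hA, l.length, fun t => x l[t], ?_, hrange x, ?_, ?_⟩
  · rw [nondominatedSet_eq hx hA]
    exact hrange fun q => outcome α β γ I (x q)
  · rw [h1, hW.count]
  · exact fun t j => hW.fst t t.2 j
  · exact fun t j => hW.snd t t.2 j
  · exact fun t => hW.value t t.2
  · exact fun t t' h => hinj (congrArg (outcome α β γ I) h)
  · rw [h0, hW.count]
  · exact fun t i => hW.bits t t.2 i

theorem runs_solver [IsOrderedAddMonoid F] (hC : SizeBound rs C) (hV : Fits rs V γ I)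
    (hα : |α| ≤ 1) (hβ : |β| ≤ 1) (hw : w ≤ n) :
    Runs rs C V (solver Kt Kh α β γ κ) (buildTime Kt Kh n + scanTime Kt Kh n) (I.input w)
      (IsCorrectOutput (feasible n w κ) (outcome α β γ I)) := by
  refine .seq ((runs_buildTable hC hV hw).imp le_rfl ?_)
  rintro s ⟨hs, hrow⟩
  have hex : ∀ q : ℕ, ∃ y : Sol n, s.iarr 3 q = 0 ∧ (∀ y, I.key y ≠ q) ∨
      IsRow I s q y ∧ I.key y = q ∧
        ∀ y', I.key y' = q → (γ : F) * sumObj I.f y ≤ γ * sumObj I.f y' := by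
    have hsupp : ∀ y : Sol n, SuppBelow n y := fun y i hi => absurd i.2 (by omega)
    intro q
    rcases hrow q with ⟨h₁, h₂⟩ | ⟨y, h₁, -, h₂, h₃⟩
    · exact ⟨fun _ => false, Or.inl ⟨h₁, fun y => h₂ y (hsupp y)⟩⟩
    · exact ⟨y, Or.inr ⟨h₁, h₂, fun y' => h₃ y' (hsupp y')⟩⟩
  choose x hx using hex
  have hrows : HasRows I s x := fun q => (hx q).imp (fun h => h.1) (fun h => h.1)
  refine (runs_scanTable hC hV hα hβ hs hrows).imp le_rfl ?_
  rintro s' ⟨h₁, h₂, h₃⟩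
  -- A feasible `y` is represented by the row of its own key. The representative has the same
  -- cardinality, so it is feasible, and its `γ f` is no larger.
  refine isCorrectOutput_of_written (fun y hy => ?_) (fun q hq => ?_) (fun q hq => hq.1) h₁ h₂ h₃
  · have hlt := I.key_lt y
    have hnn := I.key_nonneg y
    rw [← numKeys_cast] at hlt
    obtain ⟨q, hq⟩ := Int.eq_ofNat_of_zero_le hnn
    rcases hx q with ⟨-, h⟩ | ⟨hr, hk, hopt⟩
    · exact absurd hq (h y)
    · have hkey : I.key (x q) = I.key y := hk.trans hq.symm
      refine ⟨q, ⟨by omega, hr.flag, ?_⟩, outcome_le_of_key_eq hkey (hopt y hq)⟩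
      rw [I.comp_eq_of_key_eq hkey (by omega), ← I.sum_bit]
      exact hy
  · have := hq.2.2
    rwa [← I.sum_bit] at this

end Correctness

/-! ### Polynomial bounds -/

def IsPoly (g : ℕ → ℕ) : Prop := ∃ p : Polynomial ℕ, ∀ m, p.eval m = g m

theorem IsPoly.const (c : ℕ) : IsPoly fun _ => c := ⟨Polynomial.C c, by simp⟩

theorem IsPoly.id : IsPoly fun m => m := ⟨Polynomial.X, by simp⟩

theorem IsPoly.add {g h : ℕ → ℕ} (hg : IsPoly g) (hh : IsPoly h) : IsPoly fun m => g m + h m := by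
  obtain ⟨p, hp⟩ := hg
  obtain ⟨q, hq⟩ := hh
  exact ⟨p + q, by simp [hp, hq]⟩

theorem IsPoly.mul {g h : ℕ → ℕ} (hg : IsPoly g) (hh : IsPoly h) : IsPoly fun m => g m * h m := by
  obtain ⟨p, hp⟩ := hg
  obtain ⟨q, hq⟩ := hh
  exact ⟨p * q, by simp [hp, hq]⟩

theorem isPoly_numKeys (Kt Kh : ℕ) : IsPoly (numKeys Kt Kh) :=
  ⟨(Polynomial.X + 1) ^ (Kt + Kh + 1), by simp [numKeys]⟩

theorem isPoly_buildTime (Kt Kh : ℕ) : IsPoly (buildTime Kt Kh) := by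
  unfold buildTime addElementTime updateTime
  repeat' first
    | exact IsPoly.const _
    | exact IsPoly.id
    | exact isPoly_numKeys Kt Kh
    | refine IsPoly.add ?_ ?_
    | refine IsPoly.mul ?_ ?_

theorem isPoly_scanTime (Kt Kh : ℕ) : IsPoly (scanTime Kt Kh) := by
  unfold scanTime scanRowTime writeTime
  repeat' first
    | exact IsPoly.const _
    | exact IsPoly.id
    | exact isPoly_numKeys Kt Kh
    | refine IsPoly.add ?_ ?_
    | refine IsPoly.mul ?_ ?_

theorem numKeys_mono {Kt Kh m n : ℕ} (h : m ≤ n) : numKeys Kt Kh m ≤ numKeys Kt Kh n := by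
  unfold numKeys; gcongr

theorem buildTime_mono {Kt Kh m n : ℕ} (h : m ≤ n) : buildTime Kt Kh m ≤ buildTime Kt Kh n := by
  have := numKeys_mono (Kt := Kt) (Kh := Kh) h
  unfold buildTime addElementTime updateTime; gcongr

theorem scanTime_mono {Kt Kh m n : ℕ} (h : m ≤ n) : scanTime Kt Kh m ≤ scanTime Kt Kh n := by
  have := numKeys_mono (Kt := Kt) (Kh := Kh) h
  unfold scanTime scanRowTime writeTime; gcongr

section Complexity

variable {F : Type} [Ring F] [LinearOrder F] [IsOrderedAddMonoid F] {Kt Kh : ℕ} {rs : F → ℕ}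
  {C : ℕ} {α β γ : ℤ}

/-- Every element has its own category entries in the input, so `n` itself, and not only its binary
length, is bounded by the encoding length. Polynomials in `n` are thus admissible. -/
theorem le_inputSize {F : Type} [Ring F] [LinearOrder F] {rs : F → ℕ} {n : ℕ} (I : Inst F Kt Kh n) (w : ℕ) : n ≤ I.inputSize rs w := by
  have h : ∑ _i : Fin n, 1 ≤ ∑ i, (intSize (((I.catT i : ℕ) : ℤ) + 1) +
      intSize (((I.catH i : ℕ) : ℤ) + 1) + rs (I.f i)) :=
    Finset.sum_le_sum fun i _ => by
      have := one_le_intSize (((I.catT i : ℕ) : ℤ) + 1)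
      omega
  simp only [Finset.sum_const, Finset.card_univ, Fintype.card_fin, smul_eq_mul, mul_one] at h
  unfold Inst.inputSize
  omega

theorem exists_poly_solver (hC : SizeBound rs C) (hα : |α| ≤ 1) (hβ : |β| ≤ 1)
    (hsum : ∀ (n : ℕ) (I : Inst F Kt Kh n) (w : ℕ) (x : Sol n),
      rs (sumObj I.f x) ≤ 2 + 2 * I.inputSize rs w) (κ : ℤ) :
    ∃ p : Polynomial ℕ, ∀ (n : ℕ) (I : Inst F Kt Kh n) (w : ℕ), w ≤ n →
      ∃ (t : ℕ) (s : Mem F), Exec rs (solver Kt Kh α β γ κ) (I.input w) t s ∧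
        t ≤ p.eval (I.inputSize rs w) ∧ IsCorrectOutput (feasible n w κ) (outcome α β γ I) s := by
  have hpoly : IsPoly fun m => (solver Kt Kh α β γ κ).wt C *
      (numKeys Kt Kh m + Kt + Kh + ((2 + 2 * m) + C * (C * intSize γ + (2 + 2 * m))) + 1) *
      (buildTime Kt Kh m + scanTime Kt Kh m) := by
    repeat' first
      | exact IsPoly.const _
      | exact IsPoly.id
      | exact isPoly_numKeys Kt Kh
      | exact isPoly_buildTime Kt Kh
      | exact isPoly_scanTime Kt Kh
      | refine IsPoly.add ?_ ?_
      | refine IsPoly.mul ?_ ?_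
  obtain ⟨p, hp⟩ := hpoly
  refine ⟨p, fun n I w hw => ?_⟩
  have hn : n ≤ I.inputSize rs w := le_inputSize I w
  set m := I.inputSize rs w with hm
  -- The memory bound adds up the number of keys and categories, the bound `2 + 2 * m` for subset
  -- sums, and the bound that `SizeBound` yields for their products with `γ`.
  have hV : Fits rs (numKeys Kt Kh m + Kt + Kh +
      ((2 + 2 * m) + C * (C * intSize γ + (2 + 2 * m)))) γ I := by
    constructor
    · have := numKeys_mono (Kt := Kt) (Kh := Kh) hn
      omega
    · intro x
      have := hsum n I w x
      omega
    · intro x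
      have h₁ := hC.mul_le (γ : F) (sumObj I.f x)
      have h₂ : C * (rs (γ : F) + rs (sumObj I.f x)) ≤ C * (C * intSize γ + (2 + 2 * m)) :=
        Nat.mul_le_mul_left _ (Nat.add_le_add (hC.int_le γ) (hsum n I w x))
      omega
  obtain ⟨t, s, h₁, h₂, h₃⟩ := runs_solver (κ := κ) hC hV hα hβ hw
  refine ⟨t, s, h₁, h₂.trans ?_, h₃⟩
  rw [hp]
  exact Nat.mul_le_mul_left _ (Nat.add_le_add (buildTime_mono hn) (scanTime_mono hn))

theorem solvesOMUCO_solver (hC : SizeBound rs C) (hα : |α| ≤ 1) (hβ : |β| ≤ 1)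
    (hsum : ∀ (n : ℕ) (I : Inst F Kt Kh n) (w : ℕ) (x : Sol n),
      rs (sumObj I.f x) ≤ 2 + 2 * I.inputSize rs w) :
    SolvesOMUCO rs Kt Kh α β γ (solver Kt Kh α β γ 0) := by
  obtain ⟨p, hp⟩ := exists_poly_solver (γ := γ) hC hα hβ hsum 0
  refine ⟨p, fun n I => ?_⟩
  simpa only [feasible_zero] using hp n I 0 (Nat.zero_le n)

theorem solvesOMCOCC_solver (hC : SizeBound rs C) (hα : |α| ≤ 1) (hβ : |β| ≤ 1)
    (hsum : ∀ (n : ℕ) (I : Inst F Kt Kh n) (w : ℕ) (x : Sol n),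
      rs (sumObj I.f x) ≤ 2 + 2 * I.inputSize rs w) :
    SolvesOMCOCC rs Kt Kh α β γ (solver Kt Kh α β γ 1) := by
  obtain ⟨p, hp⟩ := exists_poly_solver (γ := γ) hC hα hβ hsum 1
  refine ⟨p, fun n I w hw => ?_⟩
  simpa only [feasible_one] using hp n I w hw

end Complexity

theorem realSize_sumObj_le {Kt Kh n : ℕ} (I : Inst ℝ Kt Kh n) (w : ℕ) (x : Sol n) :
    realSize (sumObj I.f x) ≤ 2 + 2 * I.inputSize realSize w := by
  unfold realSize
  omega

theorem ratSize_sumObj_le_inputSize {Kt Kh n : ℕ} (I : Inst ℚ Kt Kh n) (w : ℕ) (x : Sol n) :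
    ratSize (sumObj I.f x) ≤ 2 + 2 * I.inputSize ratSize w := by
  have h₁ := ratSize_sumObj_le I.f x
  have h₂ : ∑ i, ratSize (I.f i) ≤ ∑ i, (intSize (((I.catT i : ℕ) : ℤ) + 1) +
      intSize (((I.catH i : ℕ) : ℤ) + 1) + ratSize (I.f i)) :=
    Finset.sum_le_sum fun i _ => Nat.le_add_left _ _
  unfold Inst.inputSize
  omega

theorem abs_le_one_of_mem {a : ℤ} (h : a ∈ ({-1, 0, 1} : Set ℤ)) : |a| ≤ 1 := by
  rcases h with rfl | rfl | rfl <;> simp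

end OrdMUCO

theorem mainTheorem1 (Kt Kh : ℕ) (α β γ : ℤ)
    (hα : α ∈ ({-1, 0, 1} : Set ℤ)) (hβ : β ∈ ({-1, 0, 1} : Set ℤ))
    (hγ : γ ∈ ({-1, 0, 1} : Set ℤ)) :
    (∃ P : OrdMUCO.Prog,
      OrdMUCO.SolvesOMUCO OrdMUCO.realSize Kt Kh α β γ P ∧
      OrdMUCO.SolvesOMUCO OrdMUCO.ratSize Kt Kh α β γ P) ∧
    (∃ P : OrdMUCO.Prog,
      OrdMUCO.SolvesOMCOCC OrdMUCO.realSize Kt Kh α β γ P ∧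
      OrdMUCO.SolvesOMCOCC OrdMUCO.ratSize Kt Kh α β γ P) := by
  have hα' := OrdMUCO.abs_le_one_of_mem hα
  have hβ' := OrdMUCO.abs_le_one_of_mem hβ
  -- The programs are `solver` with `κ = 0` and `κ = 1`. They contain no constants from `F`, so the
  -- same program serves real and rational coefficients.
  exact ⟨⟨_, OrdMUCO.solvesOMUCO_solver OrdMUCO.sizeBound_realSize hα' hβ'
        fun _ => OrdMUCO.realSize_sumObj_le,
      OrdMUCO.solvesOMUCO_solver OrdMUCO.sizeBound_ratSize hα' hβ'
        fun _ => OrdMUCO.ratSize_sumObj_le_inputSize⟩,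
    ⟨_, OrdMUCO.solvesOMCOCC_solver OrdMUCO.sizeBound_realSize hα' hβ'
        fun _ => OrdMUCO.realSize_sumObj_le,
      OrdMUCO.solvesOMCOCC_solver OrdMUCO.sizeBound_ratSize hα' hβ'
        fun _ => OrdMUCO.ratSize_sumObj_le_inputSize⟩⟩
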